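/- Let $\mathcal X$ be a finite alphabet and let $\mu_0\neq\mu_1$ be probability distributions on $\mathcal X$ with $\mu_1\ll\mu_0$. All logarithms are to base $2$ and $D(p\|q)=\sum_a p(a)\log\frac{p(a)}{q(a)}$. Training samples $x_1,x_2,\dots$ are i.i.d. with law $\mu_0$. The observations $Y_1,Y_2,\dots$ are independent of each other and of the training samples. Under $P_m$ ($m\ge1$), $Y_i\sim\mu_0$ for $i<m$ and $Y_i\sim\mu_1$ for $i\ge m$; under $P_0$ all $Y_i\sim\mu_0$. A test is an extended stopping time $S$ (with values in $\{0,1,2,\dots\}\cup\{\infty\}$) such that the event $S\le n$ is determined by the training samples and $Y_1,\dots,Y_n$. Put $$\bar{\mathbb E}_1(S\mid x_1,x_2,\dots)=\sup_{m\ge1}\operatorname{ess\,sup}\,\mathbb E_m\big[(S-m+1)^+\mid x_1,x_2,\dots;\,Y_1,\dots,Y_{m-1}\big],$$ where the essential supremum is over $Y_1,\dots,Y_{m-1}$ with the training samples fixed, and let $\bar{\mathbb E}_1(S)$ be the $\mu_0$-essential supremum of this quantity over the training samples (so it is Lorden's worst-case delay if $S$ does not use the training samples). For real $\gamma$ let $\mathcal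 S_\gamma$ be the class of tests with $\mathbb E_0(S)>\gamma$, where $\mathbb E_0$ averages over the training samples and the observations. Let $\mathcal M$ be a class of memoryless sources on $\mathcal X$ with $\mu_1\in\mathcal M$. For each $n$ let $L:\mathcal X^n\to\mathbb N$ be the length function of a binary prefix code, and suppose that the code is strongly universal for $\mathcal M$: $\sup_{\mu\in\mathcal M}\max_{u\in\mathcal X^n}\big(L(u)+\log\mu(u)\big)=o(n)$. Let $\hat\mu_0$ be the empirical distribution of $x_1,\dots,x_{n_0}$. For $\lambda\in\mathbb R$ and $\eta>1$, the CUSUM test based on the empirical distribution and the code is $$M=\inf\Big\{n\ge1:\ \max_{1\le k\le n}\big(-L(Y_k^n)-\log\hat\mu_0(Y_k^n)-(n-k+1)\lambda\big)\ge\log\eta\Big\},$$ with $\hat\mu_0(Y_k^n)=\prod_{i=k}^n\hat\mu_0(Y_i)$ and $-\log 0=+\infty$. Then for every $\kappa>0$ one can choose, for each $\gamma$, a training length $n_0(\gamma)$ and a threshold $\eta(\gamma)$ (deterministic, with $\eta(\gamma)>1$ for $\gamma>1$ and $n_0(\gamma)\to\infty$ as $\gamma\to\infty$) such that the test $M_\gamma$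 with these parameters and with $\lambda=D(\mu_1\|\hat\mu_0)-\frac{D(\mu_1\|\mu_0)}{1+\kappa}$ (letters with $\hat\mu_0(a)=0$ being omitted from the sum $D(\mu_1\|\hat\mu_0)$) belongs to $\mathcal S_\gamma$ for every $\gamma>1$ and, for $\mu_0$-almost every training sequence $x_1,x_2,\dots$, $$\bar{\mathbb E}_1(M_\gamma\mid x_1,x_2,\dots)\ \sim\ (1+\kappa)\inf_{S\in\mathcal S_\gamma}\bar{\mathbb E}_1(S)\qquad(\gamma\to\infty).$$ -/

import Mathlib

open MeasureTheory ProbabilityTheory Filter Topology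
open scoped ENNReal

namespace ChangeDetection

/-! ### Codes -/

/-- A binary prefix code for each block length `n`: an injective map of the blocks of length `n`
to finite binary strings, no codeword being a proper initial segment of another one. -/
structure PrefixCode (X : Type*) where
  enc : (n : ℕ) → (Fin n → X) → List Bool
  injective : ∀ n, Function.Injective (enc n)
  prefixFree : ∀ n (u v : Fin n → X), enc n u <+: enc n v → enc n u = enc n v

/-- The code length `L(u)`. -/
def PrefixCode.len {X : Type*} (φ : PrefixCode X) {n : ℕ} (u : Fin n → X) : ℕ :=
  (φ.enc n u).length

/-- Probability `q(u) = ∏ q(u_i)` of a block under the memoryless source with one-letter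
probabilities `q`. -/
noncomputable def blockProb {X : Type*} (q : X → ℝ) {n : ℕ} (u : Fin n → X) : ℝ :=
  ∏ i, q (u i)

/-- The real-valued one-letter probabilities of a distribution on the alphabet. -/
noncomputable def probs {X : Type*} (μ : PMF X) : X → ℝ := fun a => (μ a).toReal

/-- The worst-case redundancy `sup_{μ ∈ 𝓜} max_{u ∈ X^n} (L(u) + log₂ μ(u))`. Blocks with
`μ(u) = 0`, for which `log₂ μ(u) = -∞`, do not contribute. Over a finite alphabet the set is bounded
above by the largest code length, and it is non-empty if `𝓜` is. -/
noncomputable def PrefixCode.redundancy {X : Type*} (φ : PrefixCode X) (𝓜 : Set (PMF X)) (n : ℕ) :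
    ℝ :=
  sSup {r : ℝ | ∃ μ ∈ 𝓜, ∃ u : Fin n → X, 0 < blockProb (probs μ) u ∧
    r = (φ.len u : ℝ) + Real.logb 2 (blockProb (probs μ) u)}

/-- Strong universality for the memoryless sources with one-letter distribution in `𝓜`. -/
def PrefixCode.IsUniversal {X : Type*} (φ : PrefixCode X) (𝓜 : Set (PMF X)) : Prop :=
  (fun n : ℕ => φ.redundancy 𝓜 n) =o[atTop] (fun n : ℕ => (n : ℝ))

/-- The divergence `D(p ‖ q) = ∑ p(a) log₂ (p(a) / q(a))` (in bits), for `p` absolutely continuous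
with respect to `q`; letters with `p(a) = 0` contribute `0`. -/
noncomputable def divergence {X : Type*} [Fintype X] (p q : X → ℝ) : ℝ :=
  ∑ a, p a * Real.logb 2 (p a / q a)

/-! ### The test

Sequences are indexed from `0` in the code: `x_i`, `y_i` with `i ≥ 1` are `x (i - 1)`, `y (i - 1)`. -/

/-- The empirical distribution of the first `n₀` training samples. -/
noncomputable def empirical {X : Type*} [DecidableEq X] (n₀ : ℕ) (x : ℕ → X) : X → ℝ :=
  fun a => ((Finset.range n₀).filter (fun i => x i = a)).card / (n₀ : ℝ)

/-- The block `y_{j+1}, …, y_{j+ℓ}`. -/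
def block {X : Type*} (y : ℕ → X) (j ℓ : ℕ) : Fin ℓ → X := fun i => y (j + i)

/-- The block `y_{j+1}, …, y_{j+ℓ}` raises an alarm:
`-L(y_{j+1}^{j+ℓ}) - log₂ q(y_{j+1}^{j+ℓ}) - ℓ λ ≥ log₂ η`, where `-log₂ 0 = +∞`. -/
def Alarm {X : Type*} (φ : PrefixCode X) (q : X → ℝ) (lam η : ℝ) (y : ℕ → X) (j ℓ : ℕ) : Prop :=
  blockProb q (block y j ℓ) = 0 ∨
    Real.logb 2 η ≤
      -(φ.len (block y j ℓ) : ℝ) - Real.logb 2 (blockProb q (block y j ℓ)) - ℓ * lam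

/-- The CUSUM test with reference distribution `q`, code `φ`, drift `lam` and threshold `η`: the
first `n ≥ 1` such that one of the blocks `y_k, …, y_n` with `1 ≤ k ≤ n` raises an alarm
(`⊤` if there is none). -/
noncomputable def cusum {X : Type*} (φ : PrefixCode X) (q : X → ℝ) (lam η : ℝ) (y : ℕ → X) : ℕ∞ :=
  sInf {t : ℕ∞ | ∃ j ℓ : ℕ, 1 ≤ ℓ ∧ Alarm φ q lam η y j ℓ ∧ t = ((j + ℓ : ℕ) : ℕ∞)}

/-- The drift `λ = D(μ₁ ‖ q) - D(μ₁ ‖ μ₀) / (1 + κ)`. -/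
noncomputable def drift {X : Type*} [Fintype X] (μ₀ μ₁ : PMF X) (κ : ℝ) (q : X → ℝ) : ℝ :=
  divergence (probs μ₁) q - divergence (probs μ₁) (probs μ₀) / (1 + κ)

/-! ### Laws, stopping times and delays -/

section

variable {X : Type*} [MeasurableSpace X]

/-- The law of an i.i.d. sequence with one-letter distribution `μ`. -/
noncomputable def iidLaw (μ : PMF X) : Measure (ℕ → X) :=
  Measure.infinitePi (fun _ : ℕ => μ.toMeasure)

/-- The law `P_m`, `m ≥ 1`, of independent observations `Y_1, Y_2, …` with change point `m`:
`Y_i ∼ μ₀` for `i < m` and `Y_i ∼ μ₁` for `i ≥ m`. -/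
noncomputable def changeLaw (μ₀ μ₁ : PMF X) (m : ℕ) : Measure (ℕ → X) :=
  Measure.infinitePi (fun i : ℕ => (if i + 1 < m then μ₀ else μ₁).toMeasure)

/-- The σ-algebra generated by the observations `Y_1, …, Y_n`. -/
abbrev obsHistory (X : Type*) [MeasurableSpace X] (n : ℕ) : MeasurableSpace (ℕ → X) :=
  MeasurableSpace.comap (fun (y : ℕ → X) (i : Fin n) => y i) inferInstance

/-- The filtration on pairs (training sequence, observation sequence): at time `n` the training
sequence and the observations `Y_1, …, Y_n` are known. -/
def history (X : Type*) [MeasurableSpace X] :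
    Filtration ℕ (inferInstance : MeasurableSpace ((ℕ → X) × (ℕ → X))) where
  seq n := MeasurableSpace.comap
    (fun (ω : (ℕ → X) × (ℕ → X)) => (ω.1, fun i : Fin n => ω.2 i)) inferInstance
  mono' := by
    intro m n hmn
    have h : Measurable (fun p : (ℕ → X) × (Fin n → X) =>
        (p.1, fun i : Fin m => p.2 (Fin.castLE hmn i))) := by fun_prop
    rintro s ⟨t, ht, rfl⟩
    exact ⟨_, h ht, rfl⟩
  le' := by
    intro n
    apply Measurable.comap_le
    fun_prop

/-- Lorden's worst-case delay
`sup_{m ≥ 1} ess sup E_m[(N - m + 1)⁺ | Y_1, …, Y_{m-1}]` of a rule `N` based on the observations.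
The subtraction in `ℕ∞` is truncated at `0`. -/
noncomputable def lordenDelay (μ₀ μ₁ : PMF X) (N : (ℕ → X) → ℕ∞) : ℝ≥0∞ :=
  ⨆ (m : ℕ) (_ : 1 ≤ m), essSup
    (condLExp (obsHistory X (m - 1)) (changeLaw μ₀ μ₁ m)
      (fun y => ((N y + 1 - (m : ℕ∞) : ℕ∞) : ℝ≥0∞)))
    (changeLaw μ₀ μ₁ m)

/-- The worst-case delay of a test `S`, given the training sequence `x`. The observations are
independent of the training sequence, so conditioning on the latter means fixing it. -/
noncomputable def delayGiven (μ₀ μ₁ : PMF X) (S : (ℕ → X) × (ℕ → X) → ℕ∞) (x : ℕ → X) : ℝ≥0∞ :=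
  lordenDelay μ₀ μ₁ (fun y => S (x, y))

/-- The worst-case delay of a test `S`; it is `lordenDelay` if `S` ignores the training
sequence. -/
noncomputable def delay (μ₀ μ₁ : PMF X) (S : (ℕ → X) × (ℕ → X) → ℕ∞) : ℝ≥0∞ :=
  essSup (delayGiven μ₀ μ₁ S) (iidLaw μ₀)

/-- The expectation `E_0(S)`, when there is no change. -/
noncomputable def noChangeMean (μ₀ : PMF X) (S : (ℕ → X) × (ℕ → X) → ℕ∞) : ℝ≥0∞ :=
  ∫⁻ ω, (S ω : ℝ≥0∞) ∂((iidLaw μ₀).prod (iidLaw μ₀))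

/-- The class `S_γ`: extended stopping times `S` with `E_0(S) > γ`. -/
def testClass (μ₀ : PMF X) (γ : ℝ) : Set ((ℕ → X) × (ℕ → X) → ℕ∞) :=
  {S | IsStoppingTime (history X) S ∧ ENNReal.ofReal γ < noChangeMean μ₀ S}

end

end ChangeDetection

/-!
Write `D` for the divergence of `μ₁` from `μ₀`. The theorem follows from two facts: the delay of the
CUSUM test with threshold `C γ` is asymptotically `(1 + κ) log γ / D` for almost every training
sequence, and the best possible delay is asymptotically `log γ / D`.

*The training sequence.* By the strong law of large numbers the empirical distribution `q` of the
training samples is eventually `LogClose` to `μ₀`: on the letters of positive probability the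
logarithms differ by at most `ε`. All bounds on the CUSUM test are uniform over such `q`; the drift
is then within `ε` of `D - D / (1 + κ)`.

*False alarms* (`exists_false_alarm_bound`). An alarm on a block of length `ℓ` means that the code
compresses it below its ideal length by `log η + ℓ (λ - ε)`. Kraft's inequality bounds the
probability of this under `μ₀` by `2 ^ (-ℓ (λ - ε)) / η` (`iidLaw_code_le`). As the drift is
positive, the sum over `ℓ` is finite, so that a threshold proportional to `γ` suffices for a mean
time to a false alarm of `3 γ`; it is enough that training succeeds with probability `1 / 2`.

*The delay of the test.* The worst case is a change at the first observation
(`lordenDelay_cusum_le`). By universality of the code and Hoeffding's inequality the score of a block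
of length `ℓ` is `ℓ (D / (1 + κ) + O(ε))` outside an event with exponentially small probability,
which gives the upper bound (`exists_lordenDelay_cusum_le`). For the lower bound
(`exists_le_lordenDelay_cusum`), Kraft's inequality, now under `μ₁`, excludes that some block is
compressed much better than that.

*Optimality* (`exists_le_delay`). If `E_0(S) > γ`, there is a time `k` such that, without a change,
a test still running at time `k` stops within `N` steps with conditional probability less than
`N / γ` (`exists_survival_gt`). If the change occurs at time `k + 1`, a change of measure multiplies
this by at most `2 ^ (N (D + ε))`, apart from an event on which the log-likelihood is atypically
large. So for `N` slightly less than `log γ / D` the test is still running after `N` steps with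
conditional probability close to `1`. The bound is attained asymptotically by the CUSUM tests with
reference distribution `μ₀` and small `κ` (`tendsto_iInf_delay`).
-/

namespace ChangeDetection

/-! ### Kraft's inequality -/

theorem PrefixCode.kraft {X : Type*} [Fintype X] (φ : PrefixCode X) (n : ℕ) :
    ∑ u : Fin n → X, (1 / 2 : ℝ) ^ φ.len u ≤ 1 := by
  classical
  by_cases hnil : ∃ u : Fin n → X, φ.enc n u = []
  · -- The empty word is a prefix of every codeword, so it is the only one.
    obtain ⟨u, hu⟩ := hnil
    have huniv : (Finset.univ : Finset (Fin n → X)) = {u} := by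
      ext v
      simp only [Finset.mem_univ, Finset.mem_singleton, true_iff]
      exact (φ.injective n (φ.prefixFree n u v (by simp [hu]))).symm
    simp [huniv, PrefixCode.len, hu]
  · push Not at hnil
    set S : Finset (List Bool) := Finset.univ.image (φ.enc n) with hS
    have hUD : InformationTheory.UniquelyDecodable (S : Set (List Bool)) := by
      intro L₁
      induction L₁ with
      | nil =>
        intro L₂ _ h₂ h
        cases L₂ with
        | nil => rfl
        | cons w L =>
          obtain ⟨u, hu⟩ : ∃ u, φ.enc n u = w := by simpa [hS] using h₂ w (by simp)
          have : w = [] := by simp at h; exact h.1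
          exact absurd (hu.trans this) (hnil u)
      | cons w L ih =>
        intro L₂ h₁ h₂ h
        obtain ⟨u, hu⟩ : ∃ u, φ.enc n u = w := by simpa [hS] using h₁ w (by simp)
        cases L₂ with
        | nil =>
          have : w = [] := by simp at h; exact h.1
          exact absurd (hu.trans this) (hnil u)
        | cons w' L' =>
          obtain ⟨u', hu'⟩ : ∃ u, φ.enc n u = w' := by simpa [hS] using h₂ w' (by simp)
          simp only [List.flatten_cons] at h
          have hw : w = w' := by
            rcases List.prefix_or_prefix_of_prefix
              (List.prefix_append w L.flatten) (h ▸ List.prefix_append w' L'.flatten) with hp | hp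
            · rw [← hu, ← hu'] at hp ⊢
              exact φ.prefixFree n u u' hp
            · rw [← hu, ← hu'] at hp ⊢
              exact (φ.prefixFree n u' u hp).symm
          subst hw
          rw [ih L' (fun v hv => h₁ v (by simp [hv])) (fun v hv => h₂ v (by simp [hv]))
            (List.append_cancel_left h)]
    have := InformationTheory.kraft_mcmillan_inequality hUD
    rw [hS, Finset.sum_image (fun _ _ _ _ h => φ.injective n h)] at this
    simpa [PrefixCode.len] using this

/-! ### One-letter and block probabilities -/

section

variable {X : Type*}

lemma probs_nonneg (p : PMF X) (a : X) : 0 ≤ probs p a := ENNReal.toReal_nonneg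

lemma probs_pos {p : PMF X} {a : X} : 0 < probs p a ↔ p a ≠ 0 := by
  simp [probs, ENNReal.toReal_pos_iff, pos_iff_ne_zero, (p.apply_lt_top a)]

lemma ofReal_blockProb (p : PMF X) {ℓ : ℕ} (u : Fin ℓ → X) :
    ENNReal.ofReal (blockProb (probs p) u) = ∏ i, p (u i) := by
  rw [blockProb, ENNReal.ofReal_prod_of_nonneg fun _ _ => probs_nonneg p _]
  exact Finset.prod_congr rfl fun i _ => ENNReal.ofReal_toReal (p.apply_ne_top _)

end

/-! ### Product laws -/

section

variable {X : Type*} [MeasurableSpace X]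

/-- The law of independent letters `Y_1, Y_2, …` with `Y_{i+1} ∼ p i`. -/
noncomputable abbrev prodLaw (p : ℕ → PMF X) : Measure (ℕ → X) :=
  Measure.infinitePi (fun i => (p i).toMeasure)

/-- The sequence `y_{k+1}, y_{k+2}, …`. -/
def shift (k : ℕ) (y : ℕ → X) : ℕ → X := fun i => y (k + i)

lemma measurable_shift (k : ℕ) : Measurable (shift (X := X) k) := by
  unfold shift; fun_prop

lemma map_shift_prodLaw (p : ℕ → PMF X) (k : ℕ) :
    (prodLaw p).map (shift k) = prodLaw (fun i => p (k + i)) :=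
  Measure.map_infinitePi_infinitePi_of_inj (P := fun i => (p i).toMeasure)
    (f := fun i => k + i) (fun _ _ h => by simpa using h)

instance (p : PMF X) : IsProbabilityMeasure (iidLaw p) := by
  unfold iidLaw; infer_instance

instance (p q : PMF X) (m : ℕ) : IsProbabilityMeasure (changeLaw p q m) := by
  unfold changeLaw; infer_instance

lemma changeLaw_one (μ₀ μ₁ : PMF X) : changeLaw μ₀ μ₁ 1 = iidLaw μ₁ := by
  simp [changeLaw, iidLaw]

lemma obsHistory_le (k : ℕ) : obsHistory X k ≤ MeasurableSpace.pi := by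
  apply Measurable.comap_le
  fun_prop

/-- The observations up to time `k` are independent of those after time `k`. -/
lemma indep_obsHistory_shift (p : ℕ → PMF X) (k : ℕ) :
    Indep (obsHistory X k) (MeasurableSpace.comap (shift (X := X) k) inferInstance)
      (prodLaw p) := by
  have h := iIndepFun_infinitePi (P := fun i => (p i).toMeasure) (X := fun _ x => x)
    (fun _ => measurable_id)
  have h' := indep_iSup_of_disjoint
    (m := fun i => MeasurableSpace.comap (fun y : ℕ → X => y i) inferInstance)
    (fun i => Measurable.comap_le (measurable_pi_apply i)) h
    (S := Set.Iio k) (T := Set.Ici k)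
    (Set.disjoint_left.2 fun i hi hi' => not_lt.2 (Set.mem_Ici.1 hi') (Set.mem_Iio.1 hi))
  refine indep_of_indep_of_le_left (indep_of_indep_of_le_right h' ?_) ?_
  · rw [MeasurableSpace.pi, MeasurableSpace.comap_iSup]
    refine iSup_le fun i => ?_
    rw [MeasurableSpace.comap_comp]
    exact le_iSup₂_of_le (k + i) (by simp) le_rfl
  · unfold obsHistory
    rw [MeasurableSpace.pi, MeasurableSpace.comap_iSup]
    refine iSup_le fun i => ?_
    rw [MeasurableSpace.comap_comp]
    exact le_iSup₂_of_le (i : ℕ) i.2 le_rfl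

/-- The part after time `k` is integrated separately over an event known at time `k`. -/
lemma setLIntegral_comp_shift (p : ℕ → PMF X) (k : ℕ) {A : Set (ℕ → X)}
    (hA : MeasurableSet[obsHistory X k] A) {f : (ℕ → X) → ℝ≥0∞} (hf : Measurable f) :
    ∫⁻ y in A, f (shift k y) ∂(prodLaw p) =
      prodLaw p A * ∫⁻ y, f y ∂(prodLaw (fun i => p (k + i))) := by
  have hA' := obsHistory_le k A hA
  rw [← map_shift_prodLaw, lintegral_map hf (measurable_shift k), ← lintegral_indicator hA',
    ← lintegral_indicator_one hA']
  have := lintegral_mul_eq_lintegral_mul_lintegral_of_independent_measurableSpace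
    (obsHistory_le k) (measurable_shift k).comap_le (indep_obsHistory_shift p k)
    (f := A.indicator fun _ => 1) (g := fun y => f (shift k y))
    ((@measurable_const _ _ _ (obsHistory X k) 1).indicator hA) (hf.comp (comap_measurable _))
  refine Eq.trans (lintegral_congr fun y => ?_) this
  by_cases hy : y ∈ A <;> simp [hy]

lemma measure_inter_shift_preimage (p : ℕ → PMF X) (k : ℕ) {A B : Set (ℕ → X)}
    (hA : MeasurableSet[obsHistory X k] A) (hB : MeasurableSet B) :
    prodLaw p (A ∩ shift k ⁻¹' B) = prodLaw p A * prodLaw (fun i => p (k + i)) B := by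
  have := setLIntegral_comp_shift p k hA (f := B.indicator 1) (measurable_one.indicator hB)
  rw [lintegral_indicator_one hB] at this
  rw [← this, Set.inter_comm, ← Measure.restrict_apply (measurable_shift k hB),
    ← lintegral_indicator_one (measurable_shift k hB)]
  rfl

lemma measurable_block (j ℓ : ℕ) : Measurable (fun y : ℕ → X => block y j ℓ) := by
  unfold block; fun_prop

variable [Fintype X] [MeasurableSingletonClass X]

/-- The probability of an event depending on a single block is a finite sum. -/
lemma prodLaw_block (p : ℕ → PMF X) (j ℓ : ℕ) (A : Set (Fin ℓ → X)) :
    prodLaw p {y | block y j ℓ ∈ A} =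
    ∑ u : Fin ℓ → X, A.indicator (fun u => ∏ i : Fin ℓ, p (j + i) (u i)) u := by
  have hmap : (prodLaw p).map (fun y => block y j ℓ) =
      Measure.pi (fun i : Fin ℓ => (p (j + i)).toMeasure) := by
    rw [← Measure.infinitePi_eq_pi]
    exact Measure.map_infinitePi_infinitePi_of_inj (P := fun i => (p i).toMeasure)
      (f := fun i : Fin ℓ => j + (i : ℕ)) (fun a b h => Fin.ext (by simpa using h))
  have : prodLaw p {y | block y j ℓ ∈ A} = (prodLaw p).map (fun y => block y j ℓ) A :=
    (Measure.map_apply (measurable_block j ℓ) A.toFinite.measurableSet).symm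
  rw [this, hmap, ← Measure.tsum_indicator_apply_singleton _ A A.toFinite.measurableSet,
    tsum_fintype]
  refine Finset.sum_congr rfl fun u _ => ?_
  by_cases hu : u ∈ A <;>
    simp [hu, Measure.pi_singleton, PMF.toMeasure_apply_singleton, -PMF.toMeasure_apply_fintype]

/-- Under the source `p`, a prefix code compresses a block to a factor `c` below its ideal length
`-log p` with probability at most `1 / c`: this is Markov's inequality for Kraft's sum. -/
lemma iidLaw_code_le (φ : PrefixCode X) (p : PMF X) {c : ℝ} (hc : 0 < c) (j ℓ : ℕ) :
    iidLaw p {y | c * blockProb (probs p) (block y j ℓ) ≤ (1 / 2) ^ φ.len (block y j ℓ)} ≤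
      ENNReal.ofReal (1 / c) := by
  refine (prodLaw_block (fun _ => p) j ℓ
    {u | c * blockProb (probs p) u ≤ (1 / 2) ^ φ.len u}).trans_le ?_
  calc _ ≤ ∑ u : Fin ℓ → X, ENNReal.ofReal (1 / c * (1 / 2) ^ φ.len u) := by
        refine Finset.sum_le_sum fun u _ => Set.indicator_apply_le' (fun hu => ?_) (by simp)
        rw [← ofReal_blockProb]
        apply ENNReal.ofReal_le_ofReal
        have hu' : c * blockProb (probs p) u ≤ (1 / 2) ^ φ.len u := hu
        rw [one_div_mul_eq_div, le_div_iff₀ hc]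
        linarith
    _ = ENNReal.ofReal (1 / c * ∑ u : Fin ℓ → X, (1 / 2) ^ φ.len u) := by
        rw [Finset.mul_sum, ENNReal.ofReal_sum_of_nonneg fun _ _ => by positivity]
    _ ≤ ENNReal.ofReal (1 / c) := by
        apply ENNReal.ofReal_le_ofReal
        exact mul_le_of_le_one_right (by positivity) (φ.kraft ℓ)

lemma ae_prodLaw_ne_zero (p : ℕ → PMF X) : ∀ᵐ y ∂(prodLaw p), ∀ i, p i (y i) ≠ 0 := by
  rw [ae_all_iff]
  intro i
  have h : ∀ᵐ a ∂((p i).toMeasure), p i a ≠ 0 := by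
    rw [ae_iff, PMF.toMeasure_apply_eq_zero_iff _ (Set.toFinite _).measurableSet]
    rw [Set.disjoint_left]
    intro a ha ha'
    simp_all [PMF.mem_support_iff]
  rw [← Measure.infinitePi_map_eval (fun i => (p i).toMeasure) i] at h
  exact ae_of_ae_map (measurable_pi_apply i).aemeasurable h

lemma ae_iidLaw_ne_zero (p : PMF X) : ∀ᵐ y ∂(iidLaw p), ∀ i, p (y i) ≠ 0 :=
  ae_prodLaw_ne_zero _

end

/-! ### Concentration and the law of large numbers -/

lemma empirical_eq_sum {X : Type*} [DecidableEq X] (n : ℕ) (x : ℕ → X) (a : X) :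
    empirical n x a = (∑ i ∈ Finset.range n, if x i = a then (1 : ℝ) else 0) / n := by
  simp [empirical]

lemma empirical_congr {X : Type*} [DecidableEq X] {n : ℕ} {x x' : ℕ → X}
    (h : ∀ i < n, x i = x' i) : empirical n x = empirical n x' := by
  ext a
  simp_rw [empirical_eq_sum]
  congr 1
  exact Finset.sum_congr rfl fun i hi => by rw [h i (Finset.mem_range.1 hi)]

section

variable {X : Type*} [MeasurableSpace X] [Fintype X] [MeasurableSingletonClass X]

/-- A set of sequences determined by the first `k` letters is measurable at time `k`. -/
lemma measurableSet_obsHistory (k : ℕ) {A : Set (ℕ → X)}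
    (h : ∀ y y' : ℕ → X, (∀ i < k, y i = y' i) → y ∈ A → y' ∈ A) :
    MeasurableSet[obsHistory X k] A := by
  refine ⟨(fun (y : ℕ → X) (i : Fin k) => y i) '' A, (Set.toFinite _).measurableSet, ?_⟩
  ext y
  refine ⟨?_, fun hy => ⟨y, hy, rfl⟩⟩
  rintro ⟨y', hy', he⟩
  exact h y' y (fun i hi => congrFun he ⟨i, hi⟩) hy'

lemma integral_iidLaw_eval (p : PMF X) (f : X → ℝ) (i : ℕ) :
    ∫ y, f (y i) ∂(iidLaw p) = ∑ a, probs p a * f a := by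
  have h := Measure.infinitePi_map_eval (fun _ : ℕ => p.toMeasure) i
  have hf : Measurable f := measurable_of_finite f
  rw [iidLaw, ← integral_map (φ := fun y : ℕ → X => y i) (measurable_pi_apply i).aemeasurable
    hf.aestronglyMeasurable, h, PMF.integral_eq_sum]
  rfl

/-- Hoeffding's inequality for the partial sums of a function of independent letters, in a form
that is uniform over all partial sums up to time `n`. -/
lemma exists_hoeffding (p : PMF X) (f : X → ℝ) :
    ∃ c : ℝ, 0 < c ∧ ∀ δ : ℝ, 0 < δ → ∀ k n : ℕ, k ≤ n →
      iidLaw p {y | δ * n ≤ |∑ i ∈ Finset.range k, f (y i) - k * ∑ a, probs p a * f a|} ≤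
        ENNReal.ofReal (2 * Real.exp (-(c * δ ^ 2 * n))) := by
  -- `R` is a positive bound for `|f|`, so that the variables `f (Y_i)` are sub-Gaussian with the
  -- parameter `R ^ 2`.
  set R : ℝ := 1 + ∑ a, |f a| with hR
  have hR0 : 0 < R := by positivity
  have hfR : ∀ a, f a ∈ Set.Icc (-R) R := by
    intro a
    have := Finset.single_le_sum (f := fun a => |f a|) (fun _ _ => abs_nonneg _)
      (Finset.mem_univ a)
    have h2 := abs_le.1 (show |f a| ≤ R by linarith)
    exact h2
  set m : ℝ := ∑ a, probs p a * f a with hm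
  set C : NNReal := (‖R - (-R)‖₊ / 2) ^ 2 with hC
  have hCR : (C : ℝ) = R ^ 2 := by
    rw [hC]
    push_cast
    rw [Real.norm_of_nonneg (by linarith)]
    ring
  have hf : Measurable f := measurable_of_finite f
  have hsub : ∀ i, HasSubgaussianMGF (fun y : ℕ → X => f (y i) - m) C (iidLaw p) := by
    intro i
    have := hasSubgaussianMGF_of_mem_Icc (μ := iidLaw p) (X := fun y : ℕ → X => f (y i))
      (a := -R) (b := R) (hf.comp (measurable_pi_apply i)).aemeasurable
      (Eventually.of_forall fun y => hfR _)
    rwa [integral_iidLaw_eval] at this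
  have hind : iIndepFun (fun i (y : ℕ → X) => f (y i) - m) (iidLaw p) :=
    iIndepFun_infinitePi (P := fun _ : ℕ => p.toMeasure) (X := fun _ a => f a - m)
      (fun _ => measurable_of_finite _)
  have hind' : iIndepFun (fun i (y : ℕ → X) => -(f (y i) - m)) (iidLaw p) :=
    iIndepFun_infinitePi (P := fun _ : ℕ => p.toMeasure) (X := fun _ a => -(f a - m))
      (fun _ => measurable_of_finite _)
  refine ⟨1 / (2 * R ^ 2), by positivity, fun δ hδ k n hkn => ?_⟩
  rcases Nat.eq_zero_or_pos n with rfl | hn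
  · refine prob_le_one.trans ?_
    simp
  rcases Nat.eq_zero_or_pos k with rfl | hk
  · have : 0 < δ * n := by positivity
    simp [this.not_ge]
  have hs : (0 : ℝ) ≤ δ * n := by positivity
  have hexp : Real.exp (-(δ * n) ^ 2 / (2 * k * C)) ≤
      Real.exp (-(1 / (2 * R ^ 2) * δ ^ 2 * n)) := by
    apply Real.exp_le_exp.2
    rw [neg_div, neg_le_neg_iff, hCR, le_div_iff₀ (by positivity)]
    have hkn' : (k : ℝ) ≤ n := by exact_mod_cast hkn
    calc 1 / (2 * R ^ 2) * δ ^ 2 * n * (2 * k * R ^ 2) = δ ^ 2 * n * k := by field_simp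
      _ ≤ δ ^ 2 * n * n := by gcongr
      _ = (δ * n) ^ 2 := by ring
  have h1 := (HasSubgaussianMGF.measure_sum_range_ge_le_of_iIndepFun hind (n := k)
    (fun i _ => hsub i) hs).trans hexp
  have h2 := (HasSubgaussianMGF.measure_sum_range_ge_le_of_iIndepFun hind' (n := k)
    (fun i _ => (hsub i).neg) hs).trans hexp
  have hsum : ∀ y : ℕ → X, ∑ i ∈ Finset.range k, f (y i) - k * m =
      ∑ i ∈ Finset.range k, (f (y i) - m) := by
    intro y; simp [Finset.sum_sub_distrib]
  calc iidLaw p {y | δ * n ≤ |∑ i ∈ Finset.range k, f (y i) - k * m|}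
      ≤ iidLaw p ({y | δ * n ≤ ∑ i ∈ Finset.range k, (f (y i) - m)} ∪
          {y | δ * n ≤ ∑ i ∈ Finset.range k, -(f (y i) - m)}) := by
        refine measure_mono fun y hy => ?_
        have hy' : δ * n ≤ |∑ i ∈ Finset.range k, f (y i) - k * m| := hy
        rw [hsum] at hy'
        simpa only [Set.mem_union, Set.mem_ofPred_eq, Finset.sum_neg_distrib] using le_abs.1 hy'
    _ ≤ _ := measure_union_le _ _
    _ ≤ ENNReal.ofReal (Real.exp (-(1 / (2 * R ^ 2) * δ ^ 2 * n))) +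
          ENNReal.ofReal (Real.exp (-(1 / (2 * R ^ 2) * δ ^ 2 * n))) := by
        rw [← ofReal_measureReal, ← ofReal_measureReal]
        exact add_le_add (ENNReal.ofReal_le_ofReal h1) (ENNReal.ofReal_le_ofReal h2)
    _ = _ := by
        rw [← ENNReal.ofReal_add (by positivity) (by positivity), ← two_mul (Real.exp _)]

lemma ae_tendsto_empirical [DecidableEq X] (p : PMF X) :
    ∀ᵐ x ∂(iidLaw p), ∀ a, Tendsto (fun n => empirical n x a) atTop (𝓝 (probs p a)) := by
  rw [ae_all_iff]
  intro a
  set f : X → ℝ := fun b => if b = a then 1 else 0 with hf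
  have hfm : Measurable f := measurable_of_finite f
  have hid : ∀ i, IdentDistrib (fun x : ℕ → X => f (x i)) (fun x => f (x 0)) (iidLaw p)
      (iidLaw p) := fun i => by
    refine IdentDistrib.comp (f := fun x : ℕ → X => x i) (g := fun x : ℕ → X => x 0) ⟨?_, ?_, ?_⟩ hfm
    · exact (measurable_pi_apply i).aemeasurable
    · exact (measurable_pi_apply 0).aemeasurable
    · rw [iidLaw, Measure.infinitePi_map_eval, Measure.infinitePi_map_eval]
  have hind : iIndepFun (fun i (x : ℕ → X) => f (x i)) (iidLaw p) :=
    iIndepFun_infinitePi (P := fun _ : ℕ => p.toMeasure) (X := fun _ => f) (fun _ => hfm)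
  have hint : Integrable (fun x : ℕ → X => f (x 0)) (iidLaw p) := by
    refine Integrable.of_mem_Icc 0 1 (hfm.comp (measurable_pi_apply 0)).aemeasurable
      (Eventually.of_forall fun x => ?_)
    by_cases h : x 0 = a <;> simp [hf, h]
  have := strong_law_ae_real (fun i (x : ℕ → X) => f (x i)) hint
    (fun i j hij => hind.indepFun hij) hid
  rw [integral_iidLaw_eval] at this
  filter_upwards [this] with x hx
  simp_rw [empirical_eq_sum]
  simpa [hf] using hx

end

/-! ### Reference distributions close to `μ₀` -/

/-- The reference distribution `q` agrees with `μ₀` up to a factor `2 ^ (±ε)` on the letters of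
positive `μ₀`-probability. Nothing is asked of the other letters. -/
def LogClose {X : Type*} (μ₀ : PMF X) (ε : ℝ) (q : X → ℝ) : Prop :=
  ∀ a, μ₀ a ≠ 0 → 0 < q a ∧ |Real.logb 2 (q a) - Real.logb 2 (probs μ₀ a)| ≤ ε

section

variable {X : Type*} {μ₀ μ₁ : PMF X} {ε : ℝ} {q : X → ℝ}

lemma logClose_probs (hε : 0 ≤ ε) : LogClose μ₀ ε (probs μ₀) :=
  fun _ ha => ⟨probs_pos.2 ha, by simpa using hε⟩

lemma blockProb_pos {ℓ : ℕ} {u : Fin ℓ → X} (h : ∀ i, 0 < q (u i)) : 0 < blockProb q u :=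
  Finset.prod_pos fun i _ => h i

lemma logb_blockProb {ℓ : ℕ} {u : Fin ℓ → X} (h : ∀ i, 0 < q (u i)) :
    Real.logb 2 (blockProb q u) = ∑ i, Real.logb 2 (q (u i)) :=
  Real.logb_prod _ _ fun i _ => (h i).ne'

lemma LogClose.blockProb_pos (h : LogClose μ₀ ε q) {ℓ : ℕ} {u : Fin ℓ → X}
    (hu : ∀ i, μ₀ (u i) ≠ 0) : 0 < blockProb q u :=
  ChangeDetection.blockProb_pos fun i => (h _ (hu i)).1

lemma LogClose.abs_logb_blockProb_sub_le (h : LogClose μ₀ ε q) {ℓ : ℕ} {u : Fin ℓ → X}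
    (hu : ∀ i, μ₀ (u i) ≠ 0) :
    |Real.logb 2 (blockProb q u) - Real.logb 2 (blockProb (probs μ₀) u)| ≤ ε * ℓ := by
  rw [logb_blockProb fun i => (h _ (hu i)).1, logb_blockProb fun i => probs_pos.2 (hu i),
    ← Finset.sum_sub_distrib]
  refine (Finset.abs_sum_le_sum_abs _ _).trans ?_
  calc _ ≤ ∑ _i : Fin ℓ, ε := Finset.sum_le_sum fun i _ => (h _ (hu i)).2
    _ = ε * ℓ := by simp [mul_comm]

/-- The log-likelihood ratio `log₂ (μ₁ / μ₀)` of a letter. -/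
noncomputable def llr (μ₀ μ₁ : PMF X) (a : X) : ℝ := Real.logb 2 (probs μ₁ a / probs μ₀ a)

lemma logb_blockProb_sub (hac : ∀ a, μ₀ a = 0 → μ₁ a = 0) {y : ℕ → X} (hy : ∀ i, μ₁ (y i) ≠ 0)
    (j ℓ : ℕ) :
    Real.logb 2 (blockProb (probs μ₁) (block y j ℓ)) -
        Real.logb 2 (blockProb (probs μ₀) (block y j ℓ)) =
      ∑ i ∈ Finset.range (j + ℓ), llr μ₀ μ₁ (y i) - ∑ i ∈ Finset.range j, llr μ₀ μ₁ (y i) := by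
  have h1 : ∀ i, 0 < probs μ₁ (y i) := fun i => probs_pos.2 (hy i)
  have h0 : ∀ i, 0 < probs μ₀ (y i) := fun i => probs_pos.2 fun h => hy i (hac _ h)
  rw [logb_blockProb (u := block y j ℓ) fun i => h1 _,
    logb_blockProb (u := block y j ℓ) fun i => h0 _, ← Finset.sum_sub_distrib,
    Finset.sum_range_add, add_sub_cancel_left, ← Fin.sum_univ_eq_sum_range
      (fun i => llr μ₀ μ₁ (y (j + i)))]
  exact Finset.sum_congr rfl fun i _ => (Real.logb_div (h1 _).ne' (h0 _).ne').symm

variable [Fintype X]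

lemma sum_probs (p : PMF X) : ∑ a, probs p a = 1 := by
  have := p.tsum_coe
  rw [tsum_fintype] at this
  simp only [probs]
  rw [← ENNReal.toReal_sum fun a _ => p.apply_ne_top a, this, ENNReal.toReal_one]

lemma LogClose.abs_drift_sub_le (hac : ∀ a, μ₀ a = 0 → μ₁ a = 0) (h : LogClose μ₀ ε q) (κ : ℝ) :
    |drift μ₀ μ₁ κ q - (divergence (probs μ₁) (probs μ₀) -
      divergence (probs μ₁) (probs μ₀) / (1 + κ))| ≤ ε := by
  have h1 : drift μ₀ μ₁ κ q - (divergence (probs μ₁) (probs μ₀) -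
      divergence (probs μ₁) (probs μ₀) / (1 + κ)) =
      ∑ a, probs μ₁ a * (Real.logb 2 (probs μ₁ a / q a) - llr μ₀ μ₁ a) := by
    simp only [drift, divergence, llr, mul_sub, Finset.sum_sub_distrib]
    ring
  rw [h1]
  refine (Finset.abs_sum_le_sum_abs _ _).trans ?_
  calc _ ≤ ∑ a, probs μ₁ a * ε := by
        refine Finset.sum_le_sum fun a _ => ?_
        rw [abs_mul, abs_of_nonneg (probs_nonneg _ _)]
        by_cases ha : μ₁ a = 0
        · simp [probs, ha]
        · have ha0 : μ₀ a ≠ 0 := fun h => ha (hac a h)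
          have hq := h a ha0
          refine mul_le_mul_of_nonneg_left ?_ (probs_nonneg _ _)
          rw [llr, Real.logb_div (probs_pos.2 ha).ne' hq.1.ne',
            Real.logb_div (probs_pos.2 ha).ne' (probs_pos.2 ha0).ne', sub_sub_sub_cancel_left,
            abs_sub_comm]
          exact hq.2
    _ = ε := by rw [← Finset.sum_mul, sum_probs, one_mul]

/-- Gibbs' inequality, in its strict form. -/
lemma divergence_pos (hne : μ₁ ≠ μ₀) (hac : ∀ a, μ₀ a = 0 → μ₁ a = 0) :
    0 < divergence (probs μ₁) (probs μ₀) := by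
  have hlog2 : 0 < Real.log 2 := Real.log_pos one_lt_two
  -- Termwise, `p log (p / q) ≥ p - q`, with equality only if `p = q`.
  have key : ∀ a, probs μ₁ a - probs μ₀ a ≤
      probs μ₁ a * Real.log (probs μ₁ a / probs μ₀ a) ∧ (probs μ₁ a ≠ probs μ₀ a →
      probs μ₁ a - probs μ₀ a < probs μ₁ a * Real.log (probs μ₁ a / probs μ₀ a)) := by
    intro a
    rcases (probs_nonneg μ₁ a).eq_or_lt with h1 | h1
    · rw [← h1]
      have h0 := probs_nonneg μ₀ a
      refine ⟨by simpa using h0, fun hn => ?_⟩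
      simpa using lt_of_le_of_ne h0 hn
    · have h0 : 0 < probs μ₀ a := probs_pos.2 fun h => probs_pos.1 h1 (hac a h)
      have hlog : Real.log (probs μ₁ a / probs μ₀ a) = -Real.log (probs μ₀ a / probs μ₁ a) := by
        rw [← Real.log_inv, inv_div]
      have hr : 0 < probs μ₀ a / probs μ₁ a := div_pos h0 h1
      have hmul : probs μ₁ a * (probs μ₀ a / probs μ₁ a - 1) = probs μ₀ a - probs μ₁ a := by
        field_simp
      rw [hlog]
      refine ⟨?_, fun hn => ?_⟩
      · have := mul_le_mul_of_nonneg_left (Real.log_le_sub_one_of_pos hr) h1.le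
        rw [hmul] at this
        linarith
      · have hr1 : probs μ₀ a / probs μ₁ a ≠ 1 := fun h => hn ((div_eq_one_iff_eq h1.ne').1 h).symm
        have := mul_lt_mul_of_pos_left (Real.log_lt_sub_one_of_pos hr hr1) h1
        rw [hmul] at this
        linarith
  obtain ⟨a, ha⟩ : ∃ a, probs μ₁ a ≠ probs μ₀ a := by
    by_contra! h
    refine hne (PMF.ext fun a => ?_)
    exact (ENNReal.toReal_eq_toReal_iff' (μ₁.apply_ne_top a) (μ₀.apply_ne_top a)).1 (h a)
  have hlt : ∑ a, (probs μ₁ a - probs μ₀ a) <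
      ∑ a, probs μ₁ a * Real.log (probs μ₁ a / probs μ₀ a) :=
    Finset.sum_lt_sum (fun a _ => (key a).1) ⟨a, Finset.mem_univ a, (key a).2 ha⟩
  rw [Finset.sum_sub_distrib, sum_probs, sum_probs, sub_self] at hlt
  have : divergence (probs μ₁) (probs μ₀) =
      (∑ a, probs μ₁ a * Real.log (probs μ₁ a / probs μ₀ a)) / Real.log 2 := by
    simp only [divergence, Real.logb, Finset.sum_div, mul_div_assoc]
  rw [this]
  positivity

variable [MeasurableSpace X] [MeasurableSingletonClass X] [DecidableEq X]

lemma ae_eventually_logClose_empirical (μ₀ : PMF X) :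
    ∀ᵐ x ∂(iidLaw μ₀), ∀ ε > 0, ∀ᶠ n in atTop, LogClose μ₀ ε (empirical n x) := by
  filter_upwards [ae_tendsto_empirical μ₀] with x hx ε hε
  unfold LogClose
  rw [eventually_all]
  intro a
  by_cases ha : μ₀ a = 0
  · simp [ha]
  have hpos := probs_pos.2 ha
  have h1 := (hx a).eventually_const_lt hpos
  have h2 : Tendsto (fun n => Real.logb 2 (empirical n x a)) atTop (𝓝 (Real.logb 2 (probs μ₀ a))) :=
    (Real.continuousAt_logb hpos.ne').tendsto.comp (hx a)
  filter_upwards [h1, Metric.tendsto_nhds.1 h2 ε hε] with n hn1 hn2 _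
  exact ⟨hn1, hn2.le⟩

lemma measurableSet_logClose_empirical (μ₀ : PMF X) (ε : ℝ) (n : ℕ) :
    MeasurableSet {x : ℕ → X | LogClose μ₀ ε (empirical n x)} := by
  refine obsHistory_le n _ (measurableSet_obsHistory n fun x x' h hx => ?_)
  rw [Set.mem_ofPred_eq, ← empirical_congr h]
  exact hx

/-- A long enough training sequence yields a good reference distribution with probability at
least `1 / 2`. -/
lemma eventually_half_le_logClose_empirical (μ₀ : PMF X) {ε : ℝ} (hε : 0 < ε) :
    ∀ᶠ n in atTop, 1 / 2 ≤ iidLaw μ₀ {x | LogClose μ₀ ε (empirical n x)} := by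
  have := tendsto_measure_of_ae_tendsto_indicator_of_isFiniteMeasure (μ := iidLaw μ₀) atTop
    (A := Set.univ) MeasurableSet.univ
    (As := fun n => {x | LogClose μ₀ ε (empirical n x)})
    (fun n => measurableSet_logClose_empirical μ₀ ε n)
    (by
      filter_upwards [ae_eventually_logClose_empirical μ₀] with x hx
      filter_upwards [hx ε hε] with n hn
      simpa using hn)
  rw [measure_univ] at this
  exact this.eventually_const_le (by simp)

end

/-! ### Integer-valued times -/

lemma toENNReal_eq_tsum (t : ℕ∞) :
    (t : ℝ≥0∞) = ∑' n : ℕ, if (n : ℕ∞) < t then 1 else 0 := by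
  induction t using ENat.recTopCoe with
  | top => simp
  | coe k =>
    rw [tsum_eq_sum (s := Finset.range k) fun n hn => by simpa using hn,
      Finset.sum_congr rfl fun n hn => if_pos (by simpa using hn)]
    simp

section

variable {Ω : Type*} [MeasurableSpace Ω] {N : Ω → ℕ∞}

lemma measurableSet_lt_of_le (hN : ∀ n : ℕ, MeasurableSet {ω | N ω ≤ n}) (n : ℕ) :
    MeasurableSet {ω | (n : ℕ∞) < N ω} := by
  simpa only [Set.compl_ofPred, not_le] using (hN n).compl

lemma measurable_toENNReal (hN : ∀ n : ℕ, MeasurableSet {ω | N ω ≤ n}) :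
    Measurable fun ω => (N ω : ℝ≥0∞) := by
  simp_rw [toENNReal_eq_tsum]
  exact Measurable.tsum fun n =>
    Measurable.ite (measurableSet_lt_of_le hN n) measurable_const measurable_const

/-- The tail-sum formula for the mean of an extended integer-valued time. -/
lemma lintegral_toENNReal (P : Measure Ω) (hN : ∀ n : ℕ, MeasurableSet {ω | N ω ≤ n}) :
    ∫⁻ ω, (N ω : ℝ≥0∞) ∂P = ∑' n : ℕ, P {ω | (n : ℕ∞) < N ω} := by
  simp_rw [toENNReal_eq_tsum]
  rw [lintegral_tsum fun n => (Measurable.ite (measurableSet_lt_of_le hN n)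
    measurable_const measurable_const).aemeasurable]
  refine tsum_congr fun n => ?_
  rw [← lintegral_indicator_one (measurableSet_lt_of_le hN n)]
  refine lintegral_congr fun ω => ?_
  by_cases h : (n : ℕ∞) < N ω <;> simp [h]

end

/-! ### Elementary properties of the CUSUM test -/

section

variable {X : Type*} {φ : PrefixCode X} {q : X → ℝ} {lam η : ℝ}

lemma cusum_le_iff {y : ℕ → X} {n : ℕ} :
    cusum φ q lam η y ≤ n ↔ ∃ j ℓ : ℕ, 1 ≤ ℓ ∧ j + ℓ ≤ n ∧ Alarm φ q lam η y j ℓ := by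
  constructor
  · intro h
    have hlt : cusum φ q lam η y < ((n + 1 : ℕ) : ℕ∞) :=
      h.trans_lt (by exact_mod_cast Nat.lt_succ_self n)
    obtain ⟨t, ⟨j, ℓ, hℓ, ha, rfl⟩, ht⟩ := sInf_lt_iff.1 hlt
    exact ⟨j, ℓ, hℓ, Nat.lt_succ_iff.1 (by exact_mod_cast ht), ha⟩
  · rintro ⟨j, ℓ, hℓ, hn, ha⟩
    have hle : cusum φ q lam η y ≤ ((j + ℓ : ℕ) : ℕ∞) := sInf_le ⟨j, ℓ, hℓ, ha, rfl⟩
    exact hle.trans (by exact_mod_cast hn)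

lemma Alarm.congr {y y' : ℕ → X} {j ℓ n : ℕ} (hn : j + ℓ ≤ n) (h : ∀ i < n, y i = y' i)
    (ha : Alarm φ q lam η y j ℓ) : Alarm φ q lam η y' j ℓ := by
  have : block y j ℓ = block y' j ℓ := funext fun i => h _ (by omega)
  unfold Alarm at *
  rwa [← this]

lemma cusum_le_of_eq {y y' : ℕ → X} {n : ℕ} (h : ∀ i < n, y i = y' i)
    (hy : cusum φ q lam η y ≤ n) : cusum φ q lam η y' ≤ n := by
  rw [cusum_le_iff] at *
  obtain ⟨j, ℓ, hℓ, hn, ha⟩ := hy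
  exact ⟨j, ℓ, hℓ, hn, ha.congr hn h⟩

/-- A test that ignores the first `k` observations does not stop earlier. -/
lemma cusum_le_cusum_shift (y : ℕ → X) (k : ℕ) :
    cusum φ q lam η y ≤ cusum φ q lam η (shift k y) + k := by
  generalize ht : cusum φ q lam η (shift k y) = t
  induction t using ENat.recTopCoe with
  | top => simp
  | coe t =>
    obtain ⟨j, ℓ, hℓ, hn, ha⟩ := cusum_le_iff.1 ht.le
    rw [← Nat.cast_add, cusum_le_iff]
    refine ⟨k + j, ℓ, hℓ, by omega, ?_⟩
    have : block y (k + j) ℓ = block (shift k y) j ℓ :=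
      funext fun i => by simp [block, shift, add_assoc]
    unfold Alarm at *
    rwa [this]

variable [Fintype X] [MeasurableSpace X] [MeasurableSingletonClass X]

lemma measurableSet_cusum_le (n : ℕ) :
    MeasurableSet[obsHistory X n] {y | cusum φ q lam η y ≤ n} :=
  measurableSet_obsHistory n fun _ _ h hy => cusum_le_of_eq h hy

/-! ### False alarms -/

/-- Kraft's inequality bounds the probability that a given block raises a false alarm. -/
lemma iidLaw_alarm_le {μ₀ : PMF X} {ε : ℝ} (hq : LogClose μ₀ ε q) (hη : 0 < η) (j ℓ : ℕ) :
    iidLaw μ₀ {y | Alarm φ q lam η y j ℓ} ≤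
      ENNReal.ofReal (1 / (η * (2 : ℝ) ^ (ℓ * (lam - ε)))) := by
  have hc : 0 < η * (2 : ℝ) ^ (ℓ * (lam - ε)) := by positivity
  refine (measure_mono_ae ?_).trans (iidLaw_code_le φ μ₀ hc j ℓ)
  filter_upwards [ae_iidLaw_ne_zero μ₀] with y hy ha
  have hb : ∀ i, μ₀ (block y j ℓ i) ≠ 0 := fun i => hy _
  have hq0 := hq.blockProb_pos hb
  have hp0 : 0 < blockProb (probs μ₀) (block y j ℓ) := blockProb_pos fun i => probs_pos.2 (hb i)
  have habs := abs_le.1 (hq.abs_logb_blockProb_sub_le hb)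
  rcases ha with ha | ha
  · exact absurd ha hq0.ne'
  · change η * (2 : ℝ) ^ (ℓ * (lam - ε)) * blockProb (probs μ₀) (block y j ℓ) ≤
      (1 / 2) ^ φ.len (block y j ℓ)
    rw [← Real.logb_le_logb one_lt_two (by positivity) (by positivity),
      Real.logb_mul hc.ne' hp0.ne', Real.logb_mul hη.ne' (by positivity), Real.logb_rpow two_pos
      (by norm_num), Real.logb_pow, one_div, Real.logb_inv, Real.logb_self_eq_one one_lt_two]
    linarith

/-- A union bound over the starting points `j < n` and all block lengths `ℓ`. -/
lemma iidLaw_cusum_le {μ₀ : PMF X} {ε : ℝ} (hε : 0 < ε) (hq : LogClose μ₀ ε q) (hη : 0 < η)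
    (hlam : 2 * ε ≤ lam) (n : ℕ) :
    iidLaw μ₀ {y | cusum φ q lam η y ≤ n} ≤
      ENNReal.ofReal (n * ((1 - (2 : ℝ) ^ (-ε))⁻¹ / η)) := by
  set r : ℝ := (2 : ℝ) ^ (-ε) with hr
  have hr0 : 0 < r := by positivity
  have hr1 : r < 1 := Real.rpow_lt_one_of_one_lt_of_neg one_lt_two (by linarith)
  have hbound : ∀ j ℓ : ℕ, iidLaw μ₀ {y | Alarm φ q lam η y j ℓ} ≤
      ENNReal.ofReal (1 / η * r ^ ℓ) := by
    intro j ℓ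
    refine (iidLaw_alarm_le hq hη j ℓ).trans (ENNReal.ofReal_le_ofReal ?_)
    rw [one_div, mul_inv, ← Real.rpow_neg two_pos.le, one_div]
    refine mul_le_mul_of_nonneg_left ?_ (by positivity)
    rw [hr, ← Real.rpow_natCast, ← Real.rpow_mul two_pos.le]
    apply Real.rpow_le_rpow_of_exponent_le one_lt_two.le
    have : (ℓ : ℝ) * ε ≤ ℓ * (lam - ε) := by gcongr; linarith
    linarith
  have hsub : {y : ℕ → X | cusum φ q lam η y ≤ n} ⊆
      ⋃ j ∈ Finset.range n, ⋃ ℓ : ℕ, {y | Alarm φ q lam η y j ℓ} := by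
    intro y hy
    obtain ⟨j, ℓ, hℓ, hn, ha⟩ := cusum_le_iff.1 hy
    simp only [Set.mem_iUnion, Finset.mem_range]
    exact ⟨j, by omega, ℓ, ha⟩
  calc _ ≤ ∑ j ∈ Finset.range n, iidLaw μ₀ (⋃ ℓ : ℕ, {y | Alarm φ q lam η y j ℓ}) :=
        (measure_mono hsub).trans (measure_biUnion_finset_le _ _)
    _ ≤ ∑ j ∈ Finset.range n, ENNReal.ofReal ((1 - r)⁻¹ / η) := by
        refine Finset.sum_le_sum fun j _ => (measure_iUnion_le _).trans ?_
        refine (ENNReal.tsum_le_tsum fun ℓ => hbound j ℓ).trans ?_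
        rw [← ENNReal.ofReal_tsum_of_nonneg (fun ℓ => by positivity)
          ((summable_geometric_of_lt_one hr0.le hr1).mul_left _), tsum_mul_left,
          tsum_geometric_of_lt_one hr0.le hr1, one_div_mul_eq_div]
    _ = _ := by
        rw [Finset.sum_const, Finset.card_range, nsmul_eq_mul, ENNReal.ofReal_mul (by positivity),
          ENNReal.ofReal_natCast]

/-- With threshold `C γ`, the mean time to a false alarm exceeds `3 γ`, uniformly over the
reference distributions `q` close to `μ₀`. -/
lemma exists_false_alarm_bound (φ : PrefixCode X) {μ₀ μ₁ : PMF X} (hne : μ₁ ≠ μ₀)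
    (hac : ∀ a, μ₀ a = 0 → μ₁ a = 0) {κ : ℝ} (hκ : 0 < κ) :
    ∃ ε : ℝ, 0 < ε ∧ ∃ C : ℝ, 1 ≤ C ∧ ∀ q : X → ℝ, LogClose μ₀ ε q → ∀ γ : ℝ, 1 < γ →
      ENNReal.ofReal (3 * γ) ≤
        ∫⁻ y, (cusum φ q (drift μ₀ μ₁ κ q) (C * γ) y : ℝ≥0∞) ∂(iidLaw μ₀) := by
  set D := divergence (probs μ₁) (probs μ₀) with hD
  have hDpos : 0 < D := divergence_pos hne hac
  -- For `LogClose μ₀ ε q` the drift is at least `D - D / (1 + κ) - ε = 2 ε`.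
  set ε : ℝ := (D - D / (1 + κ)) / 3 with hε
  have hε0 : 0 < ε := by
    have : D / (1 + κ) < D := div_lt_self hDpos (by linarith)
    rw [hε]; linarith
  set B : ℝ := (1 - (2 : ℝ) ^ (-ε))⁻¹ with hB
  have hr1 : (2 : ℝ) ^ (-ε) < 1 := Real.rpow_lt_one_of_one_lt_of_neg one_lt_two (by linarith)
  have hr0 : 0 < (2 : ℝ) ^ (-ε) := by positivity
  have hB1 : 1 ≤ B := (one_le_inv₀ (by linarith)).2 (by linarith)
  refine ⟨ε, hε0, 14 * B, by linarith, fun q hq γ hγ => ?_⟩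
  have hη : 0 < 14 * B * γ := by positivity
  have hlam : 2 * ε ≤ drift μ₀ μ₁ κ q := by
    have := (abs_le.1 (hq.abs_drift_sub_le hac κ)).1
    linarith
  set N := cusum φ q (drift μ₀ μ₁ κ q) (14 * B * γ) with hN
  -- The test runs for at least `6 γ` steps with probability at least `1 / 2`.
  set K : ℕ := ⌈6 * γ⌉₊ with hK
  have hK1 : 6 * γ ≤ K := Nat.le_ceil _
  have hK2 : (K : ℝ) ≤ 7 * γ := by
    have := Nat.ceil_lt_add_one (show 0 ≤ 6 * γ by linarith)
    linarith
  have hmeas : MeasurableSet {y | N y ≤ K} := obsHistory_le K _ (measurableSet_cusum_le K)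
  have hle : iidLaw μ₀ {y | N y ≤ K} ≤ ENNReal.ofReal (1 / 2) := by
    refine (iidLaw_cusum_le hε0 hq hη hlam K).trans (ENNReal.ofReal_le_ofReal ?_)
    rw [← hB, ← mul_div_assoc, div_le_iff₀ hη]
    nlinarith
  have hcompl : ENNReal.ofReal (1 / 2) ≤ iidLaw μ₀ {y | N y ≤ K}ᶜ := by
    rw [prob_compl_eq_one_sub hmeas]
    refine (le_of_eq ?_).trans (tsub_le_tsub_left hle 1)
    rw [← ENNReal.ofReal_one, ← ENNReal.ofReal_sub _ (by norm_num)]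
    norm_num
  calc ENNReal.ofReal (3 * γ) ≤ ENNReal.ofReal (K * (1 / 2)) :=
        ENNReal.ofReal_le_ofReal (by linarith)
    _ = (K : ℝ≥0∞) * ENNReal.ofReal (1 / 2) := by
        rw [ENNReal.ofReal_mul (by positivity), ENNReal.ofReal_natCast]
    _ ≤ (K : ℝ≥0∞) * iidLaw μ₀ {y | N y ≤ K}ᶜ := by gcongr
    _ = ∫⁻ _ in {y | N y ≤ K}ᶜ, (K : ℝ≥0∞) ∂(iidLaw μ₀) := by rw [setLIntegral_const]
    _ ≤ ∫⁻ y in {y | N y ≤ K}ᶜ, (N y : ℝ≥0∞) ∂(iidLaw μ₀) := by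
        refine setLIntegral_mono' hmeas.compl fun y hy => ?_
        have hy' : ¬ N y ≤ K := hy
        have : (K : ℕ∞) ≤ N y := (not_le.1 hy').le
        exact_mod_cast ENat.toENNReal_le.2 this
    _ ≤ _ := setLIntegral_le_lintegral _ _

/-! ### Lorden's delay -/

variable {μ₀ μ₁ : PMF X}

omit [Fintype X] [MeasurableSingletonClass X] in
/-- The delay for the change point `k + 1`, integrated over an event known at time `k`. -/
lemma setLIntegral_le_lordenDelay (N : (ℕ → X) → ℕ∞) (k : ℕ) {A : Set (ℕ → X)}
    (hA : MeasurableSet[obsHistory X k] A) :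
    ∫⁻ y in A, ((N y + 1 - ((k + 1 : ℕ) : ℕ∞) : ℕ∞) : ℝ≥0∞) ∂(changeLaw μ₀ μ₁ (k + 1)) ≤
      lordenDelay μ₀ μ₁ N * changeLaw μ₀ μ₁ (k + 1) A := by
  rw [← setLIntegral_condLExp (obsHistory_le k) _ _ hA, ← setLIntegral_const]
  refine lintegral_mono_ae (ae_restrict_of_ae ?_)
  have h : essSup (condLExp (obsHistory X (k + 1 - 1)) (changeLaw μ₀ μ₁ (k + 1))
      (fun y => ((N y + 1 - ((k + 1 : ℕ) : ℕ∞) : ℕ∞) : ℝ≥0∞))) (changeLaw μ₀ μ₁ (k + 1)) ≤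
      lordenDelay μ₀ μ₁ N :=
    le_iSup₂_of_le (f := fun (m : ℕ) (_ : 1 ≤ m) => essSup
      (condLExp (obsHistory X (m - 1)) (changeLaw μ₀ μ₁ m)
        (fun y => ((N y + 1 - (m : ℕ∞) : ℕ∞) : ℝ≥0∞))) (changeLaw μ₀ μ₁ m))
      (k + 1) (by omega) le_rfl
  filter_upwards [ENNReal.ae_le_essSup (μ := changeLaw μ₀ μ₁ (k + 1))
    (condLExp (obsHistory X k) (changeLaw μ₀ μ₁ (k + 1))
      (fun y => ((N y + 1 - ((k + 1 : ℕ) : ℕ∞) : ℕ∞) : ℝ≥0∞)))] with y hy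
  exact hy.trans h

omit [Fintype X] [MeasurableSingletonClass X] in
/-- Markov's inequality for the worst-case delay: if the change occurs at time `k + 1`, then a test
still running at time `k` is running `n` steps later with conditional probability at most
`lordenDelay / n`. -/
lemma natCast_mul_changeLaw_le (N : (ℕ → X) → ℕ∞) (k n : ℕ)
    (hk : MeasurableSet[obsHistory X k] {y | N y ≤ k}) (hn : MeasurableSet {y | N y ≤ (k + n : ℕ)}) :
    (n : ℝ≥0∞) * changeLaw μ₀ μ₁ (k + 1) {y | ((k + n : ℕ) : ℕ∞) < N y} ≤
      lordenDelay μ₀ μ₁ N * changeLaw μ₀ μ₁ (k + 1) {y | (k : ℕ∞) < N y} := by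
  have hA : MeasurableSet[obsHistory X k] {y | (k : ℕ∞) < N y} := by
    simpa only [Set.compl_ofPred, not_le] using hk.compl
  have hB : MeasurableSet {y | ((k + n : ℕ) : ℕ∞) < N y} := by
    simpa only [Set.compl_ofPred, not_le] using hn.compl
  refine le_trans ?_ (setLIntegral_le_lordenDelay N k hA)
  rw [← setLIntegral_const]
  refine (setLIntegral_mono' hB fun y hy => ?_).trans (lintegral_mono_set fun y hy => ?_)
  · have hy' : ((k + n : ℕ) : ℕ∞) < N y := hy
    have h : (n : ℕ∞) ≤ N y + 1 - ((k + 1 : ℕ) : ℕ∞) := by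
      generalize N y = t at hy'
      induction t using ENat.recTopCoe with
      | top =>
        have : (⊤ : ℕ∞) + 1 - ((k + 1 : ℕ) : ℕ∞) = ⊤ := by
          rw [top_add, ENat.top_sub_natCast]
        rw [this]
        exact le_top
      | coe t =>
        have : k + n < t := by exact_mod_cast hy'
        have : n ≤ t + 1 - (k + 1) := by omega
        exact_mod_cast this
    exact_mod_cast ENat.toENNReal_le.2 h
  · have hy' : ((k + n : ℕ) : ℕ∞) < N y := hy
    exact lt_of_le_of_lt (by exact_mod_cast Nat.le_add_right k n) hy'

/-- Restarting the CUSUM test at the change point only delays it, so that its worst-case delay is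
at most its mean when the change occurs at the first observation. -/
lemma lordenDelay_cusum_le :
    lordenDelay μ₀ μ₁ (cusum φ q lam η) ≤
      ∫⁻ y, (cusum φ q lam η y : ℝ≥0∞) ∂(iidLaw μ₁) := by
  refine iSup₂_le fun m hm => ?_
  obtain ⟨k, rfl⟩ : ∃ k, m = k + 1 := ⟨m - 1, by omega⟩
  refine essSup_le_of_ae_le _ (ae_le_of_ae_le_trim (hm := obsHistory_le k) ?_)
  refine ae_le_of_forall_setLIntegral_le_of_sigmaFinite (measurable_condLExp _ _ _) fun A hA _ => ?_
  rw [Nat.add_sub_cancel, setLIntegral_condLExp_trim (obsHistory_le k) _ _ hA, setLIntegral_const,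
    trim_measurableSet_eq (obsHistory_le k) hA]
  have hmeas : Measurable fun y : ℕ → X => (cusum φ q lam η y : ℝ≥0∞) :=
    measurable_toENNReal fun n => obsHistory_le n _ (measurableSet_cusum_le n)
  have h := setLIntegral_comp_shift (fun i => if i + 1 < k + 1 then μ₀ else μ₁) k hA hmeas
  have hlaw : prodLaw (fun i => if k + i + 1 < k + 1 then μ₀ else μ₁) = iidLaw μ₁ := by
    simp [iidLaw]
  rw [hlaw] at h
  refine le_trans (lintegral_mono fun y => ?_) (h.le.trans_eq (mul_comm _ _))
  apply ENat.toENNReal_le.2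
  rw [tsub_le_iff_right, Nat.cast_add, ← add_assoc, Nat.cast_one]
  gcongr
  exact cusum_le_cusum_shift y k

end

/-! ### The delay of the CUSUM test -/

lemma tendsto_succ_pow_mul_pow {r : ℝ} (hr0 : 0 < r) (hr1 : r < 1) (k : ℕ) :
    Tendsto (fun n : ℕ => ((n : ℝ) + 1) ^ k * r ^ n) atTop (𝓝 0) := by
  have h := (tendsto_pow_const_mul_const_pow_of_abs_lt_one k
    (show |r| < 1 by rwa [abs_of_pos hr0])).comp (tendsto_add_atTop_nat 1)
  have h' := h.mul_const r⁻¹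
  rw [zero_mul] at h'
  refine h'.congr fun n => ?_
  simp only [Function.comp_apply, Nat.cast_add, Nat.cast_one, pow_succ r]
  field_simp

section

variable {X : Type*} [Fintype X] {φ : PrefixCode X} {μ₀ μ₁ : PMF X}

lemma blockProb_le_one (p : PMF X) {n : ℕ} (u : Fin n → X) : blockProb (probs p) u ≤ 1 := by
  refine Finset.prod_le_one (fun i _ => probs_nonneg _ _) fun i _ => ?_
  rw [← sum_probs p]
  exact Finset.single_le_sum (fun a _ => probs_nonneg p a) (Finset.mem_univ _)

lemma PrefixCode.len_add_logb_le (φ : PrefixCode X) {𝓜 : Set (PMF X)} (hμ₁ : μ₁ ∈ 𝓜) {n : ℕ}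
    {u : Fin n → X} (hu : 0 < blockProb (probs μ₁) u) :
    (φ.len u : ℝ) + Real.logb 2 (blockProb (probs μ₁) u) ≤ φ.redundancy 𝓜 n := by
  refine le_csSup ⟨∑ v : Fin n → X, (φ.len v : ℝ), ?_⟩ ⟨μ₁, hμ₁, u, hu, rfl⟩
  rintro r ⟨μ, -, v, hv, rfl⟩
  have h1 : Real.logb 2 (blockProb (probs μ) v) ≤ 0 :=
    Real.logb_nonpos one_lt_two hv.le (blockProb_le_one μ v)
  have h2 := Finset.single_le_sum (f := fun v : Fin n → X => (φ.len v : ℝ))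
    (fun _ _ => Nat.cast_nonneg _) (Finset.mem_univ v)
  linarith

variable [MeasurableSpace X] [MeasurableSingletonClass X]

/-- Upper bound for the worst-case delay. After the change, a block of `ℓ ≥ n` letters fails to
raise an alarm only if its log-likelihood deviates from `ℓ D` by `ε ℓ`, which has exponentially
small probability. -/
lemma exists_lordenDelay_cusum_le (hac : ∀ a, μ₀ a = 0 → μ₁ a = 0) {𝓜 : Set (PMF X)}
    (hμ₁ : μ₁ ∈ 𝓜) (hφ : φ.IsUniversal 𝓜) (κ : ℝ) {ε : ℝ} (hε : 0 < ε)
    (hεD : 4 * ε < divergence (probs μ₁) (probs μ₀) / (1 + κ)) :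
    ∃ (n₁ : ℕ) (C : ℝ), ∀ q : X → ℝ, LogClose μ₀ ε q → ∀ (η : ℝ) (n : ℕ), n₁ ≤ n →
      Real.logb 2 η ≤ n * (divergence (probs μ₁) (probs μ₀) / (1 + κ) - 4 * ε) →
      lordenDelay μ₀ μ₁ (cusum φ q (drift μ₀ μ₁ κ q) η) ≤ ENNReal.ofReal (n + C) := by
  obtain ⟨c, hc, hH⟩ := exists_hoeffding μ₁ (llr μ₀ μ₁)
  set D := divergence (probs μ₁) (probs μ₀) with hD
  have hDsum : ∑ a, probs μ₁ a * llr μ₀ μ₁ a = D := rfl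
  rw [hDsum] at hH
  obtain ⟨n₂, hn₂⟩ := eventually_atTop.1 (hφ.def hε)
  set r : ℝ := Real.exp (-(c * ε ^ 2)) with hr
  have hr0 : 0 < r := Real.exp_pos _
  have hr1 : r < 1 := Real.exp_lt_one_iff.2 (neg_lt_zero.2 (by positivity))
  have hrpow : ∀ ℓ : ℕ, Real.exp (-(c * ε ^ 2 * ℓ)) = r ^ ℓ := by
    intro ℓ
    rw [hr, ← Real.exp_nat_mul]
    congr 1; ring
  refine ⟨max 1 n₂, 2 * (1 - r)⁻¹, fun q hq η n hn hη => ?_⟩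
  have hn1 : 1 ≤ n := (le_max_left _ _).trans hn
  set N := cusum φ q (drift μ₀ μ₁ κ q) η with hN
  have htail : ∀ ℓ : ℕ, n ≤ ℓ →
      iidLaw μ₁ {y | (ℓ : ℕ∞) < N y} ≤ ENNReal.ofReal (2 * r ^ ℓ) := by
    intro ℓ hℓ
    rw [← hrpow]
    refine (measure_mono_ae ?_).trans (hH ε hε ℓ ℓ le_rfl)
    filter_upwards [ae_iidLaw_ne_zero μ₁] with y hy hlt
    change ε * ℓ ≤ |∑ i ∈ Finset.range ℓ, llr μ₀ μ₁ (y i) - ℓ * D|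
    by_contra! hdev
    refine absurd (show N y ≤ ℓ from cusum_le_iff.2 ⟨0, ℓ, hn1.trans hℓ, by omega, Or.inr ?_⟩)
      (not_le.2 hlt)
    have hp1 : 0 < blockProb (probs μ₁) (block y 0 ℓ) :=
      blockProb_pos fun i => probs_pos.2 (hy _)
    have hred := φ.len_add_logb_le hμ₁ hp1
    have hred' := (le_abs_self _).trans (hn₂ ℓ (((le_max_right _ _).trans hn).trans hℓ))
    rw [Real.norm_of_nonneg (Nat.cast_nonneg ℓ)] at hred'
    have hclose := (abs_le.1 (hq.abs_logb_blockProb_sub_le (u := block y 0 ℓ)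
      fun i h => hy _ (hac _ h))).2
    have hllr := logb_blockProb_sub hac hy 0 ℓ
    rw [zero_add, Finset.range_zero, Finset.sum_empty, sub_zero] at hllr
    have hdrift := (abs_le.1 (hq.abs_drift_sub_le hac κ)).2
    have hdev' := (abs_lt.1 hdev).1
    have hℓ' : (n : ℝ) ≤ ℓ := by exact_mod_cast hℓ
    have h1 : (n : ℝ) * (D / (1 + κ) - 4 * ε) ≤ ℓ * (D / (1 + κ) - 4 * ε) :=
      mul_le_mul_of_nonneg_right hℓ' (by linarith)
    have h2 : (ℓ : ℝ) * drift μ₀ μ₁ κ q ≤ ℓ * (D - D / (1 + κ) + ε) :=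
      mul_le_mul_of_nonneg_left (by linarith) (Nat.cast_nonneg ℓ)
    linarith
  refine lordenDelay_cusum_le.trans ?_
  rw [lintegral_toENNReal _ fun n => obsHistory_le n _ (measurableSet_cusum_le n)]
  calc ∑' ℓ : ℕ, iidLaw μ₁ {y | (ℓ : ℕ∞) < N y}
      ≤ ∑' ℓ : ℕ, ((if (ℓ : ℕ∞) < (n : ℕ∞) then 1 else 0) + ENNReal.ofReal (2 * r ^ ℓ)) := by
        refine ENNReal.tsum_le_tsum fun ℓ => ?_
        rcases lt_or_ge ℓ n with h | h
        · rw [if_pos (by exact_mod_cast h)]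
          exact prob_le_one.trans le_self_add
        · exact (htail ℓ h).trans le_add_self
    _ = (n : ℝ≥0∞) + ENNReal.ofReal (2 * (1 - r)⁻¹) := by
        rw [ENNReal.tsum_add, ← toENNReal_eq_tsum, ← ENNReal.ofReal_tsum_of_nonneg
          (fun ℓ => by positivity) ((summable_geometric_of_lt_one hr0.le hr1).mul_left _),
          tsum_mul_left, tsum_geometric_of_lt_one hr0.le hr1, ENat.toENNReal_coe]
    _ = ENNReal.ofReal (n + 2 * (1 - r)⁻¹) := by
        have : 0 ≤ (1 - r)⁻¹ := inv_nonneg.2 (by linarith)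
        rw [ENNReal.ofReal_add (by positivity) (by positivity), ENNReal.ofReal_natCast]

/-- Lower bound for the worst-case delay. Before time `n` an alarm needs either a codeword that is
shorter than `-log μ₁` by `ε n`, which is excluded by Kraft's inequality, or a deviation by `ε n` of
one of the partial sums of the log-likelihood ratios. -/
lemma exists_le_lordenDelay_cusum (φ : PrefixCode X) (hac : ∀ a, μ₀ a = 0 → μ₁ a = 0) (κ : ℝ)
    {ε : ℝ} (hε : 0 < ε) (hD' : 0 < divergence (probs μ₁) (probs μ₀) / (1 + κ)) :
    ∃ w : ℕ → ℝ, Tendsto w atTop (𝓝 0) ∧ ∀ q : X → ℝ, LogClose μ₀ ε q → ∀ (η : ℝ) (n : ℕ),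
      n * (divergence (probs μ₁) (probs μ₀) / (1 + κ) + 5 * ε) ≤ Real.logb 2 η →
      ENNReal.ofReal (n * (1 - w n)) ≤
        lordenDelay μ₀ μ₁ (cusum φ q (drift μ₀ μ₁ κ q) η) := by
  obtain ⟨c, hc, hH⟩ := exists_hoeffding μ₁ (llr μ₀ μ₁)
  set D := divergence (probs μ₁) (probs μ₀) with hD
  have hDsum : ∑ a, probs μ₁ a * llr μ₀ μ₁ a = D := rfl
  rw [hDsum] at hH
  set r : ℝ := Real.exp (-(c * ε ^ 2)) with hr
  have hr0 : 0 < r := Real.exp_pos _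
  have hr1 : r < 1 := Real.exp_lt_one_iff.2 (neg_lt_zero.2 (by positivity))
  have hrpow : ∀ ℓ : ℕ, Real.exp (-(c * ε ^ 2 * ℓ)) = r ^ ℓ := by
    intro ℓ
    rw [hr, ← Real.exp_nat_mul]
    congr 1; ring
  set s : ℝ := (2 : ℝ) ^ (-ε) with hs
  have hs0 : 0 < s := by positivity
  have hs1 : s < 1 := Real.rpow_lt_one_of_one_lt_of_neg one_lt_two (by linarith)
  have hspow : ∀ n : ℕ, 1 / (2 : ℝ) ^ (ε * n) = s ^ n := by
    intro n
    rw [hs, ← Real.rpow_natCast, ← Real.rpow_mul two_pos.le, one_div, ← Real.rpow_neg two_pos.le,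
      neg_mul]
  refine ⟨fun n => ((n : ℝ) + 1) ^ 2 * s ^ n + 2 * (((n : ℝ) + 1) ^ 1 * r ^ n), ?_,
    fun q hq η n hη => ?_⟩
  · simpa using (tendsto_succ_pow_mul_pow hs0 hs1 2).add
      ((tendsto_succ_pow_mul_pow hr0 hr1 1).const_mul 2)
  set N := cusum φ q (drift μ₀ μ₁ κ q) η with hN
  set w : ℝ := ((n : ℝ) + 1) ^ 2 * s ^ n + 2 * (((n : ℝ) + 1) ^ 1 * r ^ n) with hw
  have hw0 : 0 ≤ w := by positivity
  -- `E j ℓ`: the block has a short codeword; `F k`: the `k`-th partial sum deviates by `ε n`.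
  let E : ℕ → ℕ → Set (ℕ → X) := fun j ℓ => {y | (2 : ℝ) ^ (ε * n) *
    blockProb (probs μ₁) (block y j ℓ) ≤ (1 / 2) ^ φ.len (block y j ℓ)}
  let F : ℕ → Set (ℕ → X) := fun k =>
    {y | ε * n ≤ |∑ i ∈ Finset.range k, llr μ₀ μ₁ (y i) - k * D|}
  have hE : ∀ j ℓ, iidLaw μ₁ (E j ℓ) ≤ ENNReal.ofReal (s ^ n) := fun j ℓ => by
    rw [← hspow]
    exact iidLaw_code_le φ μ₁ (by positivity) j ℓ
  have hF : ∀ k ∈ Finset.range (n + 1), iidLaw μ₁ (F k) ≤ ENNReal.ofReal (2 * r ^ n) := by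
    intro k hk
    rw [← hrpow]
    exact hH ε hε k n (Nat.lt_succ_iff.1 (Finset.mem_range.1 hk))
  have hsub : ∀ᵐ y ∂(iidLaw μ₁), N y ≤ n →
      y ∈ (⋃ j ∈ Finset.range (n + 1), ⋃ ℓ ∈ Finset.range (n + 1), E j ℓ) ∪
        ⋃ k ∈ Finset.range (n + 1), F k := by
    filter_upwards [ae_iidLaw_ne_zero μ₁] with y hy hle
    by_contra hcon
    simp only [Set.mem_union, Set.mem_iUnion, not_or, not_exists, Finset.mem_range,
      Nat.lt_succ_iff] at hcon
    obtain ⟨j, ℓ, hℓ, hjℓ, ha⟩ := cusum_le_iff.1 hle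
    have hEn : ¬ (2 : ℝ) ^ (ε * n) * blockProb (probs μ₁) (block y j ℓ) ≤
      (1 / 2) ^ φ.len (block y j ℓ) := hcon.1 j (by omega) ℓ (by omega)
    have hF1 : ¬ ε * n ≤ |∑ i ∈ Finset.range j, llr μ₀ μ₁ (y i) - j * D| :=
      hcon.2 j (by omega)
    have hF2 : ¬ ε * n ≤ |∑ i ∈ Finset.range (j + ℓ), llr μ₀ μ₁ (y i) - (j + ℓ : ℕ) * D| :=
      hcon.2 (j + ℓ) hjℓ
    have hb : ∀ i, μ₀ (block y j ℓ i) ≠ 0 := fun i h => hy _ (hac _ h)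
    have hp1 : 0 < blockProb (probs μ₁) (block y j ℓ) :=
      blockProb_pos fun i => probs_pos.2 (hy _)
    have hq0 := hq.blockProb_pos hb
    rcases ha with ha | ha
    · exact hq0.ne' ha
    have hclose := (abs_le.1 (hq.abs_logb_blockProb_sub_le hb)).1
    have hllr := logb_blockProb_sub hac hy j ℓ
    have hdrift := (abs_le.1 (hq.abs_drift_sub_le hac κ)).1
    have h1 := (abs_lt.1 (not_le.1 hF1)).1
    have h2 := (abs_lt.1 (not_le.1 hF2)).2
    have h3 : -(φ.len (block y j ℓ) : ℝ) <
        ε * n + Real.logb 2 (blockProb (probs μ₁) (block y j ℓ)) := by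
      have := Real.logb_lt_logb one_lt_two (by positivity) (not_le.1 hEn)
      rwa [Real.logb_mul (by positivity) hp1.ne', Real.logb_rpow two_pos (by norm_num),
        Real.logb_pow, one_div, Real.logb_inv, Real.logb_self_eq_one one_lt_two, mul_neg,
        mul_one] at this
    have hℓn : (ℓ : ℝ) ≤ n := by exact_mod_cast (by omega : ℓ ≤ n)
    have h4 : (ℓ : ℝ) * (D - D / (1 + κ) - ε) ≤ ℓ * drift μ₀ μ₁ κ q :=
      mul_le_mul_of_nonneg_left (by linarith) (Nat.cast_nonneg ℓ)
    have h5 : (ℓ : ℝ) * (D / (1 + κ) + 2 * ε) ≤ n * (D / (1 + κ) + 2 * ε) :=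
      mul_le_mul_of_nonneg_right hℓn (by positivity)
    push_cast at h2
    linarith
  have hle : iidLaw μ₁ {y | N y ≤ n} ≤ ENNReal.ofReal w := by
    calc iidLaw μ₁ {y | N y ≤ n}
        ≤ iidLaw μ₁ ((⋃ j ∈ Finset.range (n + 1), ⋃ ℓ ∈ Finset.range (n + 1), E j ℓ) ∪
          ⋃ k ∈ Finset.range (n + 1), F k) := measure_mono_ae hsub
      _ ≤ ∑ _j ∈ Finset.range (n + 1), ∑ _ℓ ∈ Finset.range (n + 1), ENNReal.ofReal (s ^ n) +
          ∑ _k ∈ Finset.range (n + 1), ENNReal.ofReal (2 * r ^ n) := by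
        refine (measure_union_le _ _).trans (add_le_add ?_ ?_)
        · refine (measure_biUnion_finset_le _ _).trans (Finset.sum_le_sum fun j _ => ?_)
          exact (measure_biUnion_finset_le _ _).trans (Finset.sum_le_sum fun ℓ _ => hE j ℓ)
        · exact (measure_biUnion_finset_le _ _).trans (Finset.sum_le_sum hF)
      _ = ENNReal.ofReal w := by
        simp only [← ENNReal.ofReal_sum_of_nonneg fun _ _ => (pow_pos hs0 n).le,
          ← ENNReal.ofReal_sum_of_nonneg fun _ _ =>
            (mul_pos two_pos (pow_pos hr0 n)).le]
        rw [← ENNReal.ofReal_sum_of_nonneg fun _ _ => by positivity,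
          ← ENNReal.ofReal_add (by positivity) (by positivity)]
        congr 1
        simp only [Finset.sum_const, Finset.card_range, nsmul_eq_mul, hw]
        push_cast
        ring
  have hmeas : MeasurableSet {y | N y ≤ n} := obsHistory_le n _ (measurableSet_cusum_le n)
  have h := natCast_mul_changeLaw_le (μ₀ := μ₀) (μ₁ := μ₁) N 0 n
    (measurableSet_cusum_le 0) (by rwa [zero_add])
  rw [zero_add, zero_add, changeLaw_one] at h
  calc ENNReal.ofReal (n * (1 - w)) = (n : ℝ≥0∞) * (1 - ENNReal.ofReal w) := by
        rw [ENNReal.ofReal_mul (by positivity), ENNReal.ofReal_natCast, ENNReal.ofReal_sub _ hw0,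
          ENNReal.ofReal_one]
    _ ≤ (n : ℝ≥0∞) * iidLaw μ₁ {y | (n : ℕ∞) < N y} := by
        gcongr
        have hc : {y | (n : ℕ∞) < N y} = {y | N y ≤ n}ᶜ := by
          simp only [Set.compl_ofPred, not_le]
        rw [hc, prob_compl_eq_one_sub hmeas]
        exact tsub_le_tsub_left hle 1
    _ ≤ lordenDelay μ₀ μ₁ N * 1 := h.trans (mul_le_mul_right prob_le_one _)
    _ = lordenDelay μ₀ μ₁ N := mul_one _

end

/-! ### Lorden's lower bound -/

/-- A time whose mean exceeds `γ` survives some window of length `N` with conditional probability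
more than `1 - N / γ`. Here `a k` is the probability of surviving up to time `k`. -/
lemma exists_survival_gt {a : ℕ → ℝ≥0∞} (ha : Antitone a) (ha0 : a 0 ≤ 1) {γ : ℝ}
    (hsum : ENNReal.ofReal γ < ∑' n, a n) {N : ℕ} (hN : N ≠ 0) (hNγ : (N : ℝ) < γ) :
    ∃ k, ENNReal.ofReal (1 - N / γ) * a k < a (k + N) := by
  by_contra! hcon
  have hN0 : (0 : ℝ) < N := by positivity
  have hγ : 0 < γ := hN0.trans hNγ
  set ρ : ℝ≥0∞ := ENNReal.ofReal (1 - N / γ) with hρ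
  have hpow : ∀ k, a (N * k) ≤ ρ ^ k := by
    intro k
    induction k with
    | zero => simpa using ha0
    | succ k ih =>
      calc a (N * (k + 1)) ≤ ρ * a (N * k) := hcon (N * k)
        _ ≤ ρ * ρ ^ k := by gcongr
        _ = ρ ^ (k + 1) := (pow_succ' ρ k).symm
  have : NeZero N := ⟨hN⟩
  refine absurd hsum (not_lt.2 ?_)
  calc ∑' n, a n = ∑' z : ℕ × Fin N, a ((Nat.divModEquiv N).symm z) :=
        ((Nat.divModEquiv N).symm.tsum_eq a).symm
    _ = ∑' (k : ℕ) (j : Fin N), a ((Nat.divModEquiv N).symm (k, j)) := ENNReal.tsum_prod'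
    _ ≤ ∑' (k : ℕ) (_j : Fin N), ρ ^ k := by
        refine ENNReal.tsum_le_tsum fun k => ENNReal.tsum_le_tsum fun j => ?_
        refine (ha ?_).trans (hpow k)
        simp only [Nat.divModEquiv_symm_apply]
        rw [mul_comm]
        exact Nat.le_add_right _ _
    _ = N * (1 - ρ)⁻¹ := by
        simp only [tsum_fintype, Finset.sum_const, Finset.card_univ, Fintype.card_fin,
          nsmul_eq_mul]
        rw [ENNReal.tsum_mul_left, ENNReal.tsum_geometric]
    _ = ENNReal.ofReal γ := by
        have h1 : 1 - ρ = ENNReal.ofReal (N / γ) := by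
          have : (N : ℝ) / γ ≤ 1 := ((div_lt_one hγ).2 hNγ).le
          rw [hρ, ← ENNReal.ofReal_one, ← ENNReal.ofReal_sub _ (by linarith)]
          congr 1; ring
        rw [h1, ← ENNReal.ofReal_inv_of_pos (by positivity), ← ENNReal.ofReal_natCast,
          ← ENNReal.ofReal_mul hN0.le]
        congr 1; field_simp

lemma block_zero {X : Type*} (y : ℕ → X) (n : ℕ) : block y 0 n = fun i : Fin n => y i :=
  funext fun i => by simp [block]

section

variable {X : Type*} [Fintype X] [MeasurableSpace X] [MeasurableSingletonClass X] {μ₀ μ₁ : PMF X}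

omit [Fintype X] [MeasurableSpace X] [MeasurableSingletonClass X] in
lemma apply_le_mul_two_rpow_llr (hac : ∀ a, μ₀ a = 0 → μ₁ a = 0) (a : X) :
    μ₁ a ≤ μ₀ a * ENNReal.ofReal ((2 : ℝ) ^ llr μ₀ μ₁ a) := by
  by_cases h1 : μ₁ a = 0
  · simp [h1]
  have p1 := probs_pos.2 h1
  have p0 : 0 < probs μ₀ a := probs_pos.2 fun h => h1 (hac a h)
  rw [llr, Real.rpow_logb two_pos (by norm_num) (div_pos p1 p0),
    ← ENNReal.ofReal_toReal (μ₀.apply_ne_top a), ← ENNReal.ofReal_toReal (μ₁.apply_ne_top a),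
    ← ENNReal.ofReal_mul ENNReal.toReal_nonneg]
  change ENNReal.ofReal (probs μ₁ a) ≤ ENNReal.ofReal (probs μ₀ a * (probs μ₁ a / probs μ₀ a))
  rw [mul_div_cancel₀ _ p0.ne']

/-- The change point `k + 1` does not affect the first `k` observations. -/
lemma changeLaw_eq_iidLaw (k : ℕ) {A : Set (ℕ → X)} (hA : MeasurableSet[obsHistory X k] A) :
    changeLaw μ₀ μ₁ (k + 1) A = iidLaw μ₀ A := by
  obtain ⟨t, -, rfl⟩ := hA
  have hset : (fun (y : ℕ → X) (i : Fin k) => y i) ⁻¹' t = {y | block y 0 k ∈ t} := by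
    ext y; simp [block_zero]
  rw [hset]
  refine (prodLaw_block _ 0 k t).trans (Eq.trans ?_ (prodLaw_block (fun _ => μ₀) 0 k t).symm)
  refine Finset.sum_congr rfl fun u _ => ?_
  congr 1
  ext u
  exact Finset.prod_congr rfl fun i _ => by simp

/-- Change of measure on the first `n` observations after the change. -/
lemma changeLaw_inter_le (hac : ∀ a, μ₀ a = 0 → μ₁ a = 0) (k n : ℕ) (t : ℝ) {B : Set (ℕ → X)}
    (hB : MeasurableSet[obsHistory X (k + n)] B) :
    changeLaw μ₀ μ₁ (k + 1) (B ∩ {y | ∑ i ∈ Finset.range n, llr μ₀ μ₁ (shift k y i) ≤ t}) ≤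
      ENNReal.ofReal ((2 : ℝ) ^ t) * iidLaw μ₀ B := by
  obtain ⟨B', -, rfl⟩ := hB
  set G : Set (Fin (k + n) → X) := {u | ∑ i : Fin n, llr μ₀ μ₁ (u (Fin.natAdd k i)) ≤ t} with hG
  have hset : (fun (y : ℕ → X) (i : Fin (k + n)) => y i) ⁻¹' B' =
      {y | block y 0 (k + n) ∈ B'} := by
    ext y; simp [block_zero]
  have hset' : (fun (y : ℕ → X) (i : Fin (k + n)) => y i) ⁻¹' B' ∩
      {y | ∑ i ∈ Finset.range n, llr μ₀ μ₁ (shift k y i) ≤ t} =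
      {y | block y 0 (k + n) ∈ B' ∩ G} := by
    ext y
    simp [block_zero, hG, shift, ← Fin.sum_univ_eq_sum_range (fun i => llr μ₀ μ₁ (y (k + i)))]
  rw [hset', hset]
  refine (prodLaw_block _ 0 (k + n) (B' ∩ G)).trans_le ?_
  rw [iidLaw, prodLaw_block (fun _ => μ₀) 0 (k + n) B', Finset.mul_sum]
  refine Finset.sum_le_sum fun u _ => Set.indicator_apply_le' (fun hu => ?_) (by simp)
  rw [Set.indicator_of_mem hu.1, Fin.prod_univ_add, Fin.prod_univ_add]
  have h1 : ∏ i : Fin k, (if 0 + ((Fin.castAdd n i : Fin (k + n)) : ℕ) + 1 < k + 1 then μ₀ else μ₁)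
      (u (Fin.castAdd n i)) = ∏ i : Fin k, μ₀ (u (Fin.castAdd n i)) :=
    Finset.prod_congr rfl fun i _ => by simp
  have h2 : ∏ i : Fin n, (if 0 + ((Fin.natAdd k i : Fin (k + n)) : ℕ) + 1 < k + 1 then μ₀ else μ₁)
      (u (Fin.natAdd k i)) = ∏ i : Fin n, μ₁ (u (Fin.natAdd k i)) :=
    Finset.prod_congr rfl fun i _ => by simp
  rw [h1, h2]
  have h3 : ∏ i : Fin n, μ₁ (u (Fin.natAdd k i)) ≤
      (∏ i : Fin n, μ₀ (u (Fin.natAdd k i))) * ENNReal.ofReal ((2 : ℝ) ^ t) := by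
    refine (Finset.prod_le_prod' fun i _ => apply_le_mul_two_rpow_llr hac _).trans ?_
    rw [Finset.prod_mul_distrib, ← ENNReal.ofReal_prod_of_nonneg fun _ _ => by positivity,
      ← Real.rpow_sum_of_pos two_pos]
    gcongr
    · norm_num
    · exact hu.2
  calc _ ≤ (∏ i : Fin k, μ₀ (u (Fin.castAdd n i))) *
        ((∏ i : Fin n, μ₀ (u (Fin.natAdd k i))) * ENNReal.ofReal ((2 : ℝ) ^ t)) := by gcongr
    _ = _ := by ring

/-- The basic inequality for a stopping rule `T` of the observations: with the change at time
`k + 1`, stopping within `n` steps is unlikely, unless it is already likely without a change. The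
number `δ` bounds the probability that the log-likelihood of the window exceeds `t`. -/
lemma natCast_mul_iidLaw_le (hac : ∀ a, μ₀ a = 0 → μ₁ a = 0) {T : (ℕ → X) → ℕ∞}
    (hT : ∀ n : ℕ, MeasurableSet[obsHistory X n] {y | T y ≤ n}) (k n : ℕ) (t : ℝ) {δ : ℝ≥0∞}
    (hδ : iidLaw μ₁ {y | t < ∑ i ∈ Finset.range n, llr μ₀ μ₁ (y i)} ≤ δ) :
    (n : ℝ≥0∞) * iidLaw μ₀ {y | (k : ℕ∞) < T y} ≤
      (n * δ + lordenDelay μ₀ μ₁ T) * iidLaw μ₀ {y | (k : ℕ∞) < T y} +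
      n * (ENNReal.ofReal ((2 : ℝ) ^ t) *
        iidLaw μ₀ {y | (k : ℕ∞) < T y ∧ T y ≤ (k + n : ℕ)}) := by
  set A : Set (ℕ → X) := {y | (k : ℕ∞) < T y} with hA
  set A' : Set (ℕ → X) := {y | ((k + n : ℕ) : ℕ∞) < T y} with hA'
  set B : Set (ℕ → X) := {y | (k : ℕ∞) < T y ∧ T y ≤ (k + n : ℕ)} with hB
  set G : Set (ℕ → X) := {y | ∑ i ∈ Finset.range n, llr μ₀ μ₁ (shift k y i) ≤ t} with hG
  set H : Set (ℕ → X) := {y | t < ∑ i ∈ Finset.range n, llr μ₀ μ₁ (y i)} with hH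
  have hAm : MeasurableSet[obsHistory X k] A := by
    simpa only [hA, Set.compl_ofPred, not_le] using (hT k).compl
  have hmono : obsHistory X k ≤ obsHistory X (k + n) := by
    rintro s ⟨s', hs', rfl⟩
    refine measurableSet_obsHistory (k + n) fun y y' h hy => ?_
    have : (fun i : Fin k => y i) = fun i : Fin k => y' i :=
      funext fun i => h i (by omega)
    rw [Set.mem_preimage] at hy ⊢
    rwa [← this]
  have hBm : MeasurableSet[obsHistory X (k + n)] B := (hmono _ hAm).inter (hT (k + n))
  have hHm : MeasurableSet H := by
    refine measurableSet_lt measurable_const (Finset.measurable_sum _ fun i _ => ?_)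
    exact (measurable_of_finite (llr μ₀ μ₁)).comp (measurable_pi_apply i)
  have h1 : changeLaw μ₀ μ₁ (k + 1) A ≤
      changeLaw μ₀ μ₁ (k + 1) A' + (changeLaw μ₀ μ₁ (k + 1) (B ∩ G) +
        changeLaw μ₀ μ₁ (k + 1) (A ∩ shift k ⁻¹' H)) := by
    refine (measure_mono ?_).trans ((measure_union_le A' _).trans
      (add_le_add le_rfl (measure_union_le _ _)))
    intro y hy
    by_cases hy1 : T y ≤ (k + n : ℕ)
    · by_cases hy2 : y ∈ G
      · exact Or.inr (Or.inl ⟨⟨hy, hy1⟩, hy2⟩)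
      · have hy3 : ¬ ∑ i ∈ Finset.range n, llr μ₀ μ₁ (shift k y i) ≤ t := hy2
        have hy4 : t < ∑ i ∈ Finset.range n, llr μ₀ μ₁ (shift k y i) := not_le.1 hy3
        exact Or.inr (Or.inr ⟨hy, hy4⟩)
    · exact Or.inl (not_le.1 hy1)
  have h2 : changeLaw μ₀ μ₁ (k + 1) (A ∩ shift k ⁻¹' H) ≤ iidLaw μ₀ A * δ := by
    have hlaw : prodLaw (fun i => if k + i + 1 < k + 1 then μ₀ else μ₁) = iidLaw μ₁ := by
      simp [iidLaw]
    have := measure_inter_shift_preimage (fun i => if i + 1 < k + 1 then μ₀ else μ₁) k hAm hHm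
    rw [hlaw] at this
    refine this.le.trans ?_
    rw [← changeLaw_eq_iidLaw (μ₁ := μ₁) k hAm]
    exact mul_le_mul' le_rfl hδ
  have h3 := changeLaw_inter_le hac k n t hBm
  have h4 := natCast_mul_changeLaw_le (μ₀ := μ₀) (μ₁ := μ₁) T k n (hT k)
    (obsHistory_le _ _ (hT (k + n)))
  rw [← hA, ← hA'] at h4
  rw [changeLaw_eq_iidLaw k hAm] at h1 h4
  calc (n : ℝ≥0∞) * iidLaw μ₀ A
      ≤ n * (changeLaw μ₀ μ₁ (k + 1) A' +
          (ENNReal.ofReal ((2 : ℝ) ^ t) * iidLaw μ₀ B + iidLaw μ₀ A * δ)) := by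
        gcongr
        exact h1.trans (by gcongr)
    _ = n * changeLaw μ₀ μ₁ (k + 1) A' +
          (n * (ENNReal.ofReal ((2 : ℝ) ^ t) * iidLaw μ₀ B) + n * (iidLaw μ₀ A * δ)) := by ring
    _ ≤ lordenDelay μ₀ μ₁ T * iidLaw μ₀ A +
          (n * (ENNReal.ofReal ((2 : ℝ) ^ t) * iidLaw μ₀ B) + n * (iidLaw μ₀ A * δ)) := by gcongr
    _ = _ := by ring

omit [Fintype X] [MeasurableSingletonClass X] in
lemma measurableSet_section_of_history {n : ℕ} {A : Set ((ℕ → X) × (ℕ → X))}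
    (hA : MeasurableSet[history X n] A) (x : ℕ → X) :
    MeasurableSet[obsHistory X n] (Prod.mk x ⁻¹' A) := by
  obtain ⟨t, ht, rfl⟩ := hA
  exact ⟨Prod.mk x ⁻¹' t, measurable_prodMk_left ht, rfl⟩

/-- Lorden's lower bound: a test with mean time to a false alarm more than `γ` has a worst-case
delay of at least `N (1 - o(1))` if `N` is a little less than `log γ / D`. -/
lemma exists_le_delay (hac : ∀ a, μ₀ a = 0 → μ₁ a = 0)
    (hD0 : 0 < divergence (probs μ₁) (probs μ₀)) {ε : ℝ} (hε : 0 < ε) :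
    ∃ w : ℕ → ℝ, Tendsto w atTop (𝓝 0) ∧ ∀ (γ : ℝ), 1 < γ → ∀ N : ℕ,
      N * (divergence (probs μ₁) (probs μ₀) + 2 * ε) ≤ Real.logb 2 γ →
      ∀ S ∈ testClass μ₀ γ, ENNReal.ofReal (N * (1 - w N)) ≤ delay μ₀ μ₁ S := by
  obtain ⟨c, hc, hH⟩ := exists_hoeffding μ₁ (llr μ₀ μ₁)
  set D := divergence (probs μ₁) (probs μ₀) with hD
  have hDsum : ∑ a, probs μ₁ a * llr μ₀ μ₁ a = D := rfl
  rw [hDsum] at hH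
  set r : ℝ := Real.exp (-(c * ε ^ 2)) with hr
  have hr0 : 0 < r := Real.exp_pos _
  have hr1 : r < 1 := Real.exp_lt_one_iff.2 (neg_lt_zero.2 (by positivity))
  have hrpow : ∀ ℓ : ℕ, Real.exp (-(c * ε ^ 2 * ℓ)) = r ^ ℓ := by
    intro ℓ
    rw [hr, ← Real.exp_nat_mul]
    congr 1; ring
  set s : ℝ := (2 : ℝ) ^ (-ε) with hs
  have hs0 : 0 < s := by positivity
  have hs1 : s < 1 := Real.rpow_lt_one_of_one_lt_of_neg one_lt_two (by linarith)
  refine ⟨fun n => 2 * r ^ n + ((n : ℝ) + 1) ^ 1 * s ^ n, ?_, fun γ hγ N hNγ S hS => ?_⟩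
  · simpa using ((tendsto_pow_atTop_nhds_zero_of_lt_one hr0.le hr1).const_mul 2).add
      (tendsto_succ_pow_mul_pow hs0 hs1 1)
  have hγ0 : 0 < γ := by linarith
  rcases Nat.eq_zero_or_pos N with rfl | hNpos
  · simp
  have hN0 : (0 : ℝ) < N := by exact_mod_cast hNpos
  -- The choice of `N` gives `2 ^ ((D + ε) N) ≤ γ 2 ^ (-ε N)`.
  have hpow : (2 : ℝ) ^ ((D + ε) * N) ≤ γ * s ^ N := by
    have h1 : s ^ N = (2 : ℝ) ^ (-(ε * N)) := by
      rw [hs, ← Real.rpow_natCast, ← Real.rpow_mul two_pos.le, neg_mul]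
    have h2 : (2 : ℝ) ^ ((D + 2 * ε) * N) ≤ γ := by
      rw [← Real.le_logb_iff_rpow_le one_lt_two hγ0]
      linarith
    have h3 : (D + ε) * N = (D + 2 * ε) * N + -(ε * N) := by ring
    rw [h1, h3, Real.rpow_add two_pos]
    gcongr
  have hpow1 : 1 ≤ (2 : ℝ) ^ ((D + ε) * N) :=
    Real.one_le_rpow one_lt_two.le (by positivity)
  rcases le_or_gt γ N with hle | hlt
  · -- For `N ≥ γ` the claimed bound is not positive.
    have h1 : 1 ≤ (N : ℝ) * s ^ N :=
      (hpow1.trans hpow).trans (mul_le_mul_of_nonneg_right hle (by positivity))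
    have h2 : 1 - (2 * r ^ N + ((N : ℝ) + 1) ^ 1 * s ^ N) ≤ 0 := by
      have := pow_pos hr0 N
      have := pow_pos hs0 N
      rw [pow_one]
      linarith
    rw [ENNReal.ofReal_of_nonpos (mul_nonpos_of_nonneg_of_nonpos hN0.le h2)]
    exact zero_le
  obtain ⟨hSt, hmean⟩ := hS
  have hSn : ∀ n : ℕ, MeasurableSet[history X n] {ω | S ω ≤ (n : ℕ∞)} := hSt
  have hmeas : ∀ n : ℕ, MeasurableSet {ω | S ω ≤ (n : ℕ∞)} :=
    fun n => (history X).le n _ (hSn n)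
  set P := (iidLaw μ₀).prod (iidLaw μ₀) with hP
  rw [noChangeMean, lintegral_toENNReal _ hmeas] at hmean
  obtain ⟨k, hk⟩ := exists_survival_gt (a := fun n : ℕ => P {ω | (n : ℕ∞) < S ω})
    (fun m n hmn => measure_mono fun ω hω =>
      lt_of_le_of_lt (show (m : ℕ∞) ≤ n by exact_mod_cast hmn) hω)
    prob_le_one hmean hNpos.ne' hlt
  have hmA : MeasurableSet {ω | (k : ℕ∞) < S ω} := measurableSet_lt_of_le hmeas k
  have hmB : MeasurableSet {ω | (k : ℕ∞) < S ω ∧ S ω ≤ (k + N : ℕ)} := hmA.inter (hmeas _)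
  set a := P {ω | (k : ℕ∞) < S ω} with ha
  set b := P {ω | (k : ℕ∞) < S ω ∧ S ω ≤ (k + N : ℕ)} with hb
  have hsplit : P {ω | ((k + N : ℕ) : ℕ∞) < S ω} + b = a := by
    rw [ha, hb, ← measure_union _ hmB]
    · congr 1
      ext ω
      constructor
      · rintro (h | h)
        · have h' : ((k + N : ℕ) : ℕ∞) < S ω := h
          exact lt_of_le_of_lt (by exact_mod_cast Nat.le_add_right k N) h'
        · exact h.1
      · intro h
        by_cases h' : S ω ≤ (k + N : ℕ)
        · exact Or.inr ⟨h, h'⟩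
        · exact Or.inl (not_le.1 h')
    · exact Set.disjoint_left.2 fun ω h h' => absurd h'.2 (not_le.2 h)
  rcases eq_or_ne (delay μ₀ μ₁ S) ⊤ with hd | hd
  · rw [hd]; exact le_top
  set δ : ℝ≥0∞ := ENNReal.ofReal (2 * r ^ N) with hδ
  have hdev : iidLaw μ₁ {y | (D + ε) * N < ∑ i ∈ Finset.range N, llr μ₀ μ₁ (y i)} ≤ δ := by
    rw [hδ, ← hrpow]
    refine (measure_mono fun y hy => ?_).trans (hH ε hε N N le_rfl)
    have hy' : (D + ε) * N < ∑ i ∈ Finset.range N, llr μ₀ μ₁ (y i) := hy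
    have h1 : ε * N ≤ ∑ i ∈ Finset.range N, llr μ₀ μ₁ (y i) - N * D := by linarith
    exact h1.trans (le_abs_self _)
  -- Integrate the inequality for fixed training sequences.
  have hint : (N : ℝ≥0∞) * a ≤ (N * δ + delay μ₀ μ₁ S) * a +
      N * (ENNReal.ofReal ((2 : ℝ) ^ ((D + ε) * N)) * b) := by
    rw [ha, hb, hP, Measure.prod_apply hmA, Measure.prod_apply hmB,
      ← lintegral_const_mul _ (measurable_measure_prodMk_left hmA),
      ← lintegral_const_mul _ (measurable_measure_prodMk_left hmA),
      ← lintegral_const_mul _ (measurable_measure_prodMk_left hmB),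
      ← lintegral_const_mul _ ((measurable_measure_prodMk_left hmB).const_mul _),
      ← lintegral_add_left ((measurable_measure_prodMk_left hmA).const_mul _)]
    refine lintegral_mono_ae ?_
    filter_upwards [ENNReal.ae_le_essSup (μ := iidLaw μ₀) (delayGiven μ₀ μ₁ S)] with x hx
    have h := natCast_mul_iidLaw_le (T := fun y => S (x, y)) hac
      (fun n => measurableSet_section_of_history (hSn n) x) k N _ hdev
    refine h.trans (add_le_add (mul_le_mul' (add_le_add le_rfl hx) le_rfl) le_rfl)
  have ha1 : a ≠ ⊤ := measure_ne_top _ _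
  have hb1 : b ≠ ⊤ := measure_ne_top _ _
  have ha'1 : P {ω | ((k + N : ℕ) : ℕ∞) < S ω} ≠ ⊤ := measure_ne_top _ _
  obtain ⟨d, hd0, hd'⟩ : ∃ d : ℝ, 0 ≤ d ∧ delay μ₀ μ₁ S = ENNReal.ofReal d :=
    ⟨_, ENNReal.toReal_nonneg, (ENNReal.ofReal_toReal hd).symm⟩
  have hρ : 0 ≤ 1 - N / γ := by
    have := (div_lt_one hγ0).2 hlt
    linarith
  have hk' : (1 - N / γ) * a.toReal < (P {ω | ((k + N : ℕ) : ℕ∞) < S ω}).toReal := by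
    have := (ENNReal.toReal_lt_toReal (ENNReal.mul_ne_top ENNReal.ofReal_ne_top ha1) ha'1).2 hk
    rwa [ENNReal.toReal_mul, ENNReal.toReal_ofReal hρ] at this
  have hsplit' : (P {ω | ((k + N : ℕ) : ℕ∞) < S ω}).toReal + b.toReal = a.toReal := by
    rw [← ENNReal.toReal_add ha'1 hb1, hsplit]
  have hb0 : 0 ≤ b.toReal := ENNReal.toReal_nonneg
  have ha0 : 0 < a.toReal := by
    have : 0 ≤ a.toReal := ENNReal.toReal_nonneg
    have := mul_nonneg hρ this
    linarith
  have hint' : (N : ℝ) * a.toReal ≤ (N * (2 * r ^ N) + d) * a.toReal +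
      N * ((2 : ℝ) ^ ((D + ε) * N) * b.toReal) := by
    have hr2 : 0 ≤ 2 * r ^ N := by positivity
    have h := hint
    rw [hd', hδ, ← ENNReal.ofReal_toReal ha1, ← ENNReal.ofReal_toReal hb1,
      ← ENNReal.ofReal_natCast, ← ENNReal.ofReal_mul hN0.le, ← ENNReal.ofReal_mul hN0.le,
      ← ENNReal.ofReal_add (by positivity) hd0, ← ENNReal.ofReal_mul (by positivity),
      ← ENNReal.ofReal_mul (by positivity), ← ENNReal.ofReal_mul hN0.le,
      ← ENNReal.ofReal_add (by positivity) (by positivity),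
      ENNReal.ofReal_le_ofReal_iff (by positivity)] at h
    exact h
  rw [hd']
  apply ENNReal.ofReal_le_ofReal
  have hb2 : b.toReal ≤ N / γ * a.toReal := by linarith
  have h5 : (2 : ℝ) ^ ((D + ε) * N) * b.toReal ≤ (N * s ^ N) * a.toReal := by
    calc _ ≤ (γ * s ^ N) * (N / γ * a.toReal) := by gcongr
      _ = _ := by field_simp
  have h6 : (N : ℝ) * a.toReal ≤ (N * (2 * r ^ N) + d + N * (N * s ^ N)) * a.toReal := by
    have := mul_le_mul_of_nonneg_left h5 hN0.le
    linarith
  have h7 := le_of_mul_le_mul_right h6 ha0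
  have h8 : 0 ≤ (N : ℝ) * s ^ N := by positivity
  change (N : ℝ) * (1 - (2 * r ^ N + ((N : ℝ) + 1) ^ 1 * s ^ N)) ≤ d
  rw [pow_one]
  linarith

end

/-! ### Asymptotics -/

/-- Converts a lower bound `n (1 - o(1))` for integers `n ≤ (L + c) / b` into the lower bound `L / a`
with any `a > b`. -/
lemma eventually_exists_nat_lower {w : ℕ → ℝ} (hw : Tendsto w atTop (𝓝 0)) {a b : ℝ} (hb : 0 < b)
    (hab : b < a) (c : ℝ) :
    ∀ᶠ L : ℝ in atTop, ∃ n : ℕ, n * b ≤ L + c ∧ L / a ≤ n * (1 - w n) := by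
  have ha : 0 < a := hb.trans hab
  have hθ1 : (a + b) / (2 * a) < 1 := by rw [div_lt_one (by positivity)]; linarith
  have hθ0 : 0 < (a + b) / (2 * a) := by positivity
  set θ : ℝ := (a + b) / (2 * a) with hθ
  -- `θ / b > 1 / a`
  have hgap : 0 < θ / b - 1 / a := by
    rw [sub_pos, div_lt_div_iff₀ ha hb, hθ, div_mul_eq_mul_div, lt_div_iff₀ (by positivity)]
    nlinarith
  have hfl : Tendsto (fun L : ℝ => ⌊(L + c) / b⌋₊) atTop atTop :=
    tendsto_nat_floor_atTop.comp
      ((tendsto_id.atTop_add (tendsto_const_nhds (x := c))).atTop_div_const hb)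
  have h1 : ∀ᶠ n in atTop, θ < 1 - w n := by
    have : Tendsto (fun n => 1 - w n) atTop (𝓝 (1 - 0)) := tendsto_const_nhds.sub hw
    rw [sub_zero] at this
    exact this.eventually_const_lt hθ1
  filter_upwards [hfl.eventually h1, eventually_ge_atTop (-c),
    eventually_ge_atTop ((θ - θ * (c / b)) / (θ / b - 1 / a))] with L hL1 hL2 hL3
  have hnn : 0 ≤ (L + c) / b := div_nonneg (by linarith) hb.le
  refine ⟨⌊(L + c) / b⌋₊, ?_, ?_⟩
  · exact (le_div_iff₀ hb).1 (Nat.floor_le hnn)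
  · rw [div_le_iff₀ hgap] at hL3
    have h2 := (Nat.sub_one_lt_floor ((L + c) / b)).le
    calc L / a = L * (1 / a) := by ring
      _ ≤ ((L + c) / b - 1) * θ := by
          have : ((L + c) / b - 1) * θ = L * (θ / b) + θ * (c / b) - θ := by ring
          linarith
      _ ≤ ⌊(L + c) / b⌋₊ * θ := mul_le_mul_of_nonneg_right h2 hθ0.le
      _ ≤ _ := mul_le_mul_of_nonneg_left hL1.le (Nat.cast_nonneg _)

/-- Converts an upper bound `n + C` for integers `n ≥ (L + c) / b` into the upper bound `L / a` with
any `a < b`. -/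
lemma eventually_exists_nat_upper {a b : ℝ} (ha : 0 < a) (hab : a < b) (n₁ : ℕ) (C c : ℝ) :
    ∀ᶠ L : ℝ in atTop, ∃ n : ℕ, n₁ ≤ n ∧ L + c ≤ n * b ∧ n + C ≤ L / a := by
  have hb : 0 < b := ha.trans hab
  have hgap : 0 < 1 / a - 1 / b := sub_pos.2 (one_div_lt_one_div_of_lt ha hab)
  filter_upwards [eventually_ge_atTop (-c), eventually_ge_atTop (n₁ * b - c),
    eventually_ge_atTop ((c / b + 1 + C) / (1 / a - 1 / b))] with L hL1 hL2 hL3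
  have hnn : 0 ≤ (L + c) / b := div_nonneg (by linarith) hb.le
  have h1 := Nat.le_ceil ((L + c) / b)
  refine ⟨⌈(L + c) / b⌉₊, ?_, (div_le_iff₀ hb).1 h1, ?_⟩
  · have h2 : (n₁ : ℝ) ≤ (L + c) / b := (le_div_iff₀ hb).2 (by linarith)
    exact_mod_cast h2.trans h1
  · have h2 := (Nat.ceil_lt_add_one hnn).le
    rw [div_le_iff₀ hgap] at hL3
    have h3 : (L + c) / b = L * (1 / b) + c / b := by ring
    have h4 : L / a = L * (1 / a) := by ring
    linarith

/-- `f` is asymptotic to `L / d` if it is eventually squeezed between the multiples `L / a` with `a`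
above and below `d`. -/
lemma tendsto_div_ofReal {f : ℝ → ℝ≥0∞} {L : ℝ → ℝ} (hL : Tendsto L atTop atTop) {d : ℝ}
    (hd : 0 < d) (hlow : ∀ a, d < a → ∀ᶠ γ in atTop, ENNReal.ofReal (L γ / a) ≤ f γ)
    (hup : ∀ a, 0 < a → a < d → ∀ᶠ γ in atTop, f γ ≤ ENNReal.ofReal (L γ / a)) :
    Tendsto (fun γ => f γ / ENNReal.ofReal (L γ)) atTop (𝓝 (ENNReal.ofReal (1 / d))) := by
  have hcont : Tendsto (fun a : ℝ => ENNReal.ofReal (1 / a)) (𝓝 d) (𝓝 (ENNReal.ofReal (1 / d))) :=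
    ENNReal.tendsto_ofReal (tendsto_const_nhds.div tendsto_id hd.ne')
  have hdiv : ∀ a l : ℝ, 0 < l →
      ENNReal.ofReal (l / a) / ENNReal.ofReal l = ENNReal.ofReal (1 / a) := by
    intro a l hl
    rw [← ENNReal.ofReal_div_of_pos hl]
    congr 1
    field_simp
  refine tendsto_order.2 ⟨fun y hy => ?_, fun y hy => ?_⟩
  · obtain ⟨a, hay, had⟩ := (((hcont.mono_left nhdsWithin_le_nhds).eventually_const_lt hy).and
      (self_mem_nhdsWithin (s := Set.Ioi d))).exists
    filter_upwards [hlow a had, hL.eventually_gt_atTop 0] with γ hγ hγ0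
    exact hay.trans_le ((hdiv a _ hγ0).symm.trans_le (ENNReal.div_le_div_right hγ _))
  · obtain ⟨a, ⟨hay, had⟩, ha0⟩ :=
      ((((hcont.mono_left nhdsWithin_le_nhds).eventually_lt_const hy).and
        (self_mem_nhdsWithin (s := Set.Iio d))).and
        (mem_nhdsWithin_of_mem_nhds (Ioi_mem_nhds hd))).exists
    filter_upwards [hup a ha0 had, hL.eventually_gt_atTop 0] with γ hγ hγ0
    exact ((ENNReal.div_le_div_right hγ _).trans_eq (hdiv a _ hγ0)).trans_lt hay

lemma tendsto_logb_two : Tendsto (Real.logb 2) atTop atTop :=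
  Real.tendsto_logb_atTop one_lt_two

section

variable {X : Type*} [Fintype X] [MeasurableSpace X] [MeasurableSingletonClass X]
  {φ : PrefixCode X} {μ₀ μ₁ : PMF X}

lemma eventually_lordenDelay_cusum_le (hac : ∀ a, μ₀ a = 0 → μ₁ a = 0) {𝓜 : Set (PMF X)}
    (hμ₁ : μ₁ ∈ 𝓜) (hφ : φ.IsUniversal 𝓜) {κ C : ℝ} (hC : 0 < C) {q : ℝ → X → ℝ}
    (hq : ∀ ε > 0, ∀ᶠ γ in atTop, LogClose μ₀ ε (q γ)) {a : ℝ} (ha : 0 < a)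
    (had : a < divergence (probs μ₁) (probs μ₀) / (1 + κ)) :
    ∀ᶠ γ in atTop, lordenDelay μ₀ μ₁ (cusum φ (q γ) (drift μ₀ μ₁ κ (q γ)) (C * γ)) ≤
      ENNReal.ofReal (Real.logb 2 γ / a) := by
  set d := divergence (probs μ₁) (probs μ₀) / (1 + κ) with hd
  set ε : ℝ := (d - a) / 8 with hε
  have hε0 : 0 < ε := by rw [hε]; linarith
  obtain ⟨n₁, K, h⟩ := exists_lordenDelay_cusum_le (κ := κ) hac hμ₁ hφ hε0 (by linarith)
  have hev := tendsto_logb_two.eventually (eventually_exists_nat_upper (a := a) (b := d - 4 * ε) ha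
    (by linarith) n₁ K (Real.logb 2 C))
  filter_upwards [hev, hq ε hε0, eventually_gt_atTop 0] with γ ⟨n, hn1, hn2, hn3⟩ hγ hγ0
  refine (h (q γ) hγ (C * γ) n hn1 ?_).trans (ENNReal.ofReal_le_ofReal hn3)
  rw [Real.logb_mul hC.ne' hγ0.ne']
  linarith

lemma eventually_le_lordenDelay_cusum (φ : PrefixCode X) (hac : ∀ a, μ₀ a = 0 → μ₁ a = 0)
    {κ C : ℝ} (hC : 0 < C) (hd0 : 0 < divergence (probs μ₁) (probs μ₀) / (1 + κ)) {q : ℝ → X → ℝ}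
    (hq : ∀ ε > 0, ∀ᶠ γ in atTop, LogClose μ₀ ε (q γ)) {a : ℝ}
    (had : divergence (probs μ₁) (probs μ₀) / (1 + κ) < a) :
    ∀ᶠ γ in atTop, ENNReal.ofReal (Real.logb 2 γ / a) ≤
      lordenDelay μ₀ μ₁ (cusum φ (q γ) (drift μ₀ μ₁ κ (q γ)) (C * γ)) := by
  set d := divergence (probs μ₁) (probs μ₀) / (1 + κ) with hd
  set ε : ℝ := (a - d) / 10 with hε
  have hε0 : 0 < ε := by rw [hε]; linarith
  obtain ⟨w, hw, h⟩ := exists_le_lordenDelay_cusum φ hac κ hε0 hd0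
  have hev := tendsto_logb_two.eventually (eventually_exists_nat_lower hw (a := a)
    (b := d + 5 * ε) (by linarith) (by linarith) (Real.logb 2 C))
  filter_upwards [hev, hq ε hε0, eventually_gt_atTop 0] with γ ⟨n, hn1, hn2⟩ hγ hγ0
  refine (ENNReal.ofReal_le_ofReal hn2).trans (h (q γ) hγ (C * γ) n ?_)
  rw [Real.logb_mul hC.ne' hγ0.ne']
  linarith

/-- A rule that uses only finitely many training samples and, up to time `n`, only the first `n`
observations is a stopping time. -/
lemma isStoppingTime_of_finite_training {S : (ℕ → X) × (ℕ → X) → ℕ∞} (n₀ : ℕ)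
    (h : ∀ (n : ℕ) (x y x' y' : ℕ → X), (∀ i < n₀, x i = x' i) → (∀ i < n, y i = y' i) →
      S (x, y) ≤ n → S (x', y') ≤ n) : IsStoppingTime (history X) S := by
  intro n
  let G : (ℕ → X) × (Fin n → X) → (Fin n₀ → X) × (Fin n → X) := fun p => (fun i => p.1 i, p.2)
  have hG : Measurable G := by fun_prop
  let F : (ℕ → X) × (ℕ → X) → (ℕ → X) × (Fin n → X) := fun ω => (ω.1, fun i => ω.2 i)
  refine ⟨G ⁻¹' ((G ∘ F) '' {ω | S ω ≤ (n : ℕ∞)}), hG (Set.toFinite _).measurableSet, ?_⟩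
  ext ω
  constructor
  · rintro ⟨ω', hω', he⟩
    have he1 := congrArg Prod.fst he
    have he2 := congrArg Prod.snd he
    exact h n ω'.1 ω'.2 ω.1 ω.2 (fun i hi => congrFun he1 ⟨i, hi⟩)
      (fun i hi => congrFun he2 ⟨i, hi⟩) hω'
  · intro hω
    exact ⟨ω, hω, rfl⟩

omit [Fintype X] [MeasurableSingletonClass X] in
/-- A stopping time is in the class `S_γ` as soon as, with probability at least `1 / 2`, the training
sequence yields a conditional mean without a change of at least `3 γ`. -/
lemma mem_testClass {S : (ℕ → X) × (ℕ → X) → ℕ∞} (hS : IsStoppingTime (history X) S) {γ : ℝ}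
    (hγ : 0 < γ) {A : Set (ℕ → X)} (hA : MeasurableSet A) (hA2 : 1 / 2 ≤ iidLaw μ₀ A)
    (h : ∀ x ∈ A, ENNReal.ofReal (3 * γ) ≤ ∫⁻ y, (S (x, y) : ℝ≥0∞) ∂(iidLaw μ₀)) :
    S ∈ testClass μ₀ γ := by
  refine ⟨hS, ?_⟩
  -- Tonelli's theorem, restricted to the training sequences in `A`.
  have hmeas : ∀ n : ℕ, MeasurableSet {ω | S ω ≤ (n : ℕ∞)} := fun n => (history X).le n _ (hS n)
  rw [noChangeMean, lintegral_prod _ (measurable_toENNReal hmeas).aemeasurable]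
  calc ENNReal.ofReal γ < ENNReal.ofReal (3 * γ) * (1 / 2) := by
        rw [one_div, ← ENNReal.ofReal_ofNat 2, ← ENNReal.ofReal_inv_of_pos two_pos,
          ← ENNReal.ofReal_mul (by positivity)]
        exact (ENNReal.ofReal_lt_ofReal_iff (by positivity)).2 (by linarith)
    _ ≤ ENNReal.ofReal (3 * γ) * iidLaw μ₀ A := by gcongr
    _ = ∫⁻ _ in A, ENNReal.ofReal (3 * γ) ∂(iidLaw μ₀) := (setLIntegral_const _ _).symm
    _ ≤ ∫⁻ x in A, ∫⁻ y, (S (x, y) : ℝ≥0∞) ∂(iidLaw μ₀) ∂(iidLaw μ₀) := setLIntegral_mono' hA h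
    _ ≤ _ := setLIntegral_le_lintegral _ _

/-- The optimal worst-case delay is asymptotically `log γ / D`. The upper bound comes from the
CUSUM tests with exact reference distribution `μ₀` and arbitrarily small `κ`. -/
lemma tendsto_iInf_delay (hne : μ₁ ≠ μ₀) (hac : ∀ a, μ₀ a = 0 → μ₁ a = 0) {𝓜 : Set (PMF X)}
    (hμ₁ : μ₁ ∈ 𝓜) (hφ : φ.IsUniversal 𝓜) :
    Tendsto (fun γ => (⨅ S ∈ testClass μ₀ γ, delay μ₀ μ₁ S) / ENNReal.ofReal (Real.logb 2 γ))
      atTop (𝓝 (ENNReal.ofReal (1 / divergence (probs μ₁) (probs μ₀)))) := by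
  have hD0 := divergence_pos hne hac
  set D := divergence (probs μ₁) (probs μ₀) with hD
  refine tendsto_div_ofReal tendsto_logb_two hD0 (fun a ha => ?_) fun a ha0 haD => ?_
  · obtain ⟨w, hw, h⟩ := exists_le_delay hac hD0 (ε := (a - D) / 4) (by linarith)
    have hev := tendsto_logb_two.eventually (eventually_exists_nat_lower hw (a := a)
      (b := D + 2 * ((a - D) / 4)) (by linarith) (by linarith) 0)
    filter_upwards [hev, eventually_gt_atTop 1] with γ ⟨n, hn1, hn2⟩ hγ
    rw [add_zero] at hn1
    exact le_iInf₂ fun S hS => (ENNReal.ofReal_le_ofReal hn2).trans (h γ hγ n hn1 S hS)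
  · set κ : ℝ := (D / a - 1) / 2 with hκ
    have h1 : 1 < D / a := (one_lt_div ha0).2 haD
    have hκ0 : 0 < κ := by rw [hκ]; linarith
    have had : a < D / (1 + κ) := by
      rw [lt_div_iff₀ (by linarith), ← lt_div_iff₀' ha0, hκ]
      linarith
    obtain ⟨ε, hε, C, hC, hfa⟩ := exists_false_alarm_bound φ hne hac hκ0
    filter_upwards [eventually_lordenDelay_cusum_le (C := C) hac hμ₁ hφ (by linarith)
      (q := fun _ => probs μ₀) (fun ε hε => Eventually.of_forall fun _ => logClose_probs hε.le)
      ha0 had, eventually_gt_atTop 1] with γ hγ hγ1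
    have hmem : (fun ω : (ℕ → X) × (ℕ → X) =>
        cusum φ (probs μ₀) (drift μ₀ μ₁ κ (probs μ₀)) (C * γ) ω.2) ∈ testClass μ₀ γ := by
      refine mem_testClass (isStoppingTime_of_finite_training 0
        fun n x y x' y' _ hy hle => cusum_le_of_eq hy hle) (by linarith)
        (MeasurableSet.univ) ?_ fun x _ => hfa _ (logClose_probs hε.le) γ hγ1
      rw [measure_univ]
      simp
    refine (iInf₂_le _ hmem).trans (le_trans ?_ hγ)
    exact essSup_le_of_ae_le _ (Eventually.of_forall fun _ => le_rfl)

end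
end ChangeDetection

theorem mainTheorem1 {X : Type*} [Fintype X] [DecidableEq X] [MeasurableSpace X]
    [MeasurableSingletonClass X] (μ₀ μ₁ : PMF X) (hne : μ₁ ≠ μ₀)
    (hac : ∀ a, μ₀ a = 0 → μ₁ a = 0)
    (𝓜 : Set (PMF X)) (hμ₁ : μ₁ ∈ 𝓜)
    (φ : ChangeDetection.PrefixCode X) (hφ : φ.IsUniversal 𝓜) (κ : ℝ) (hκ : 0 < κ) :
    ∃ (n₀ : ℝ → ℕ) (η : ℝ → ℝ) (M : ℝ → (ℕ → X) × (ℕ → X) → ℕ∞),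
      Tendsto n₀ atTop atTop ∧ (∀ γ, 1 < γ → 1 < η γ) ∧
      (∀ γ x y, M γ (x, y) =
        ChangeDetection.cusum φ (ChangeDetection.empirical (n₀ γ) x)
          (ChangeDetection.drift μ₀ μ₁ κ (ChangeDetection.empirical (n₀ γ) x)) (η γ) y) ∧
      (∀ γ, 1 < γ → M γ ∈ ChangeDetection.testClass μ₀ γ) ∧
      ∀ᵐ x ∂(ChangeDetection.iidLaw μ₀),
        Tendsto (fun γ : ℝ => ChangeDetection.delayGiven μ₀ μ₁ (M γ) x /
            (ENNReal.ofReal (1 + κ) *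
              ⨅ S ∈ ChangeDetection.testClass μ₀ γ, ChangeDetection.delay μ₀ μ₁ S))
          atTop (𝓝 1) := by
  open ChangeDetection in
  have hD0 := divergence_pos hne hac
  obtain ⟨ε, hε, C, hC, hfa⟩ := exists_false_alarm_bound φ hne hac hκ
  have hC0 : 0 < C := by linarith
  obtain ⟨n₁, hn₁⟩ := eventually_atTop.1 (eventually_half_le_logClose_empirical μ₀ hε)
  have hn₀ : Tendsto (fun γ : ℝ => n₁ + ⌈γ⌉₊) atTop atTop :=
    tendsto_atTop_mono (fun _ => Nat.le_add_left _ _) tendsto_nat_ceil_atTop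
  refine ⟨fun γ => n₁ + ⌈γ⌉₊, fun γ => C * γ, fun γ ω =>
    cusum φ (empirical (n₁ + ⌈γ⌉₊) ω.1) (drift μ₀ μ₁ κ (empirical (n₁ + ⌈γ⌉₊) ω.1)) (C * γ) ω.2,
    hn₀, fun γ hγ => by nlinarith, fun _ _ _ => rfl, fun γ hγ => ?_, ?_⟩
  · refine mem_testClass (isStoppingTime_of_finite_training (n₁ + ⌈γ⌉₊)
      fun n x y x' y' hx hy hle => ?_) (by linarith)
      (measurableSet_logClose_empirical μ₀ ε (n₁ + ⌈γ⌉₊)) (hn₁ _ (Nat.le_add_right _ _))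
      fun x hx => hfa _ hx γ hγ
    change cusum φ (empirical _ x') (drift μ₀ μ₁ κ (empirical _ x')) _ y' ≤ n
    rw [← empirical_congr hx]
    exact cusum_le_of_eq hy hle
  · filter_upwards [ae_eventually_logClose_empirical μ₀] with x hx
    set D := divergence (probs μ₁) (probs μ₀) with hD
    have hd0 : 0 < D / (1 + κ) := by positivity
    have hq : ∀ ε > 0, ∀ᶠ γ in atTop, LogClose μ₀ ε (empirical (n₁ + ⌈γ⌉₊) x) :=
      fun ε hε => hn₀.eventually (hx ε hε)
    have h1 := tendsto_div_ofReal tendsto_logb_two hd0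
      (fun a ha => eventually_le_lordenDelay_cusum φ hac hC0 hd0 hq ha)
      (fun a ha0 had => eventually_lordenDelay_cusum_le hac hμ₁ hφ hC0 hq ha0 had)
    have h2 := ENNReal.Tendsto.const_mul (a := ENNReal.ofReal (1 + κ))
      (tendsto_iInf_delay hne hac hμ₁ hφ) (Or.inr ENNReal.ofReal_ne_top)
    have hlim : ENNReal.ofReal (1 + κ) * ENNReal.ofReal (1 / D) =
        ENNReal.ofReal (1 / (D / (1 + κ))) := by
      rw [← ENNReal.ofReal_mul (by linarith)]
      congr 1
      field_simp
    rw [hlim] at h2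
    have hne0 : ENNReal.ofReal (1 / (D / (1 + κ))) ≠ 0 := by
      rw [Ne, ENNReal.ofReal_eq_zero, not_le]
      positivity
    have h3 := ENNReal.Tendsto.div h1 (Or.inl hne0) h2 (Or.inl ENNReal.ofReal_ne_top)
    rw [ENNReal.div_self hne0 ENNReal.ofReal_ne_top] at h3
    -- The factors `log γ` cancel as soon as they are positive.
    refine h3.congr' ?_
    filter_upwards [tendsto_logb_two.eventually_gt_atTop 0] with γ hγ
    have hL0 : ENNReal.ofReal (Real.logb 2 γ) ≠ 0 := by
      rwa [Ne, ENNReal.ofReal_eq_zero, not_le]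
    rw [div_eq_mul_inv _ (ENNReal.ofReal (Real.logb 2 γ)),
      div_eq_mul_inv _ (ENNReal.ofReal (Real.logb 2 γ)), ← mul_assoc,
      ENNReal.mul_div_mul_right _ _ (ENNReal.inv_ne_zero.2 ENNReal.ofReal_ne_top)
        (ENNReal.inv_ne_top.2 hL0)]
    rfl
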